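/- Conventions. Let $K$ be a field. A graph $E=(E^0,E^1,r,s)$ is directed, with finite vertex set $E^0$, finite edge set $E^1$, and range and source maps $r,s:E^1\to E^0$ (loops and multiple edges are allowed); it has no sinks if every vertex is the source of an edge. The Leavitt path algebra $\mathcal L(E)$ is the $K$-algebra generated by the $v\in E^0$ and by $\alpha,\alpha^*$ for $\alpha\in E^1$, subject to $vw=\delta_{vw}v$; $s(\alpha)\alpha=\alpha r(\alpha)=\alpha$ and $r(\alpha)\alpha^*=\alpha^*s(\alpha)=\alpha^*$; $\alpha^*\beta=\delta_{\alpha\beta}r(\alpha)$; and $\sum_{s(\alpha)=v}\alpha\alpha^*=v$ whenever $s^{-1}(v)\neq\emptyset$; its identity is $\sum_{v\in E^0}v$. For an abelian group $\Gamma$, a map $w:E^1\to\Gamma$ gives a $\Gamma$-grading of $\mathcal L(E)$ with $\deg v=0$, $\deg\alpha=w(\alpha)$, $\deg\alpha^*=-w(\alpha)$. $E_1$ and $E_2$ are elementary strong shift equivalent via $E_3$ if $E_3^0$ is the disjoint union of $E_1^0$ and $E_2^0$, every edge of $E_3$ goes either from $E_1^0$ to $E_2^0$ or from $E_2^0$ to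 $E_1^0$, and for $i=1,2$ there is a range- and source-preserving bijection from $E_i^1$ onto the set of paths of length $2$ in $E_3$ that start and end in $E_i^0$. For $\Gamma$-graded rings $A$ and $B$, let $\operatorname{Gr-}A$ be the category of $\Gamma$-graded right $A$-modules with degree-preserving homomorphisms, and let $\mathcal T_\alpha:M\mapsto M(\alpha)$, $M(\alpha)_\gamma=M_{\alpha+\gamma}$, be the shift functors. $A$ and $B$ are graded Morita equivalent if there are functors $\phi:\operatorname{Gr-}A\to\operatorname{Gr-}B$ and $\psi:\operatorname{Gr-}B\to\operatorname{Gr-}A$ with $\phi\mathcal T_\alpha=\mathcal T_\alpha\phi$ and $\psi\mathcal T_\alpha=\mathcal T_\alpha\psi$ for all $\alpha\in\Gamma$, $\psi\phi\cong 1_{\operatorname{Gr-}A}$ and $\phi\psi\cong 1_{\operatorname{Gr-}B}$. Theorem. Let $E_1$ and $E_2$ be graphs with no sinks that are elementary strong shift equivalent via a graph $E_3$. Let $(1/2)\mathbb Z$ be the subgroup of $\mathbb Q$ generated by $1/2$. Grade $\mathcal L(E_1)$ and $\mathcal L(E_2)$ by $(1/2)\mathbb Z$ with all edges of degree $1$,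 and $\mathcal L(E_3)$ with all edges of degree $1/2$. Then $\mathcal L(E_1)$ and $\mathcal L(E_2)$ are graded Morita equivalent as $(1/2)\mathbb Z$-graded rings. Moreover, for $i=1,2$, the element $p_i=\sum_{v\in E_i^0}v\in\mathcal L(E_3)$ is a full homogeneous idempotent of degree $0$ (that is, $p_i^2=p_i$ and $\mathcal L(E_3)\,p_i\,\mathcal L(E_3)=\mathcal L(E_3)$), and $\mathcal L(E_i)$ is isomorphic as a $(1/2)\mathbb Z$-graded $K$-algebra to the corner $p_i\mathcal L(E_3)p_i$. -/

import Mathlib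

open CategoryTheory

universe u v

/-! ### Graded right modules and graded Morita equivalence -/

/-- A `Γ`-graded right module over a ring `A` with grading `𝒜`. Right `A`-modules are modules
over `Aᵐᵒᵖ`, so that `MulOpposite.op a • m` is the product `m a`. -/
structure GrMod {Γ : Type*} [AddCommGroup Γ] [DecidableEq Γ] {A : Type u} [Ring A]
    {σ : Type*} [SetLike σ A] (𝒜 : Γ → σ) where
  carrier : Type v
  [addCommGroup : AddCommGroup carrier]
  [module : Module Aᵐᵒᵖ carrier]
  /-- the homogeneous components -/
  piece : Γ → AddSubgroup carrier
  isInternal : DirectSum.IsInternal piece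
  op_smul_mem : ∀ (i j : Γ) (m : carrier) (a : A), m ∈ piece i → a ∈ 𝒜 j →
    MulOpposite.op a • m ∈ piece (i + j)

namespace GrMod

attribute [instance] GrMod.addCommGroup GrMod.module

theorem isInternal_iff {Γ M : Type*} [DecidableEq Γ] [AddCommGroup M] (p : Γ → AddSubgroup M) :
    DirectSum.IsInternal p ↔ iSupIndep p ∧ iSup p = ⊤ := by
  constructor
  · intro h
    refine ⟨h.addSubgroup_iSupIndep, ?_⟩
    rw [eq_top_iff]
    intro x _
    obtain ⟨y, rfl⟩ := h.2 x
    induction y using DirectSum.induction_on with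
    | zero => simp
    | of i x =>
      rw [DirectSum.coeAddMonoidHom_of]
      exact AddSubgroup.mem_iSup_of_mem i x.2
    | add a b ha hb => rw [map_add]; exact add_mem (ha trivial) (hb trivial)
  · rintro ⟨h1, h2⟩
    refine ⟨iSupIndep.dfinsuppSumAddHom_injective h1, fun x => ?_⟩
    have hx : x ∈ iSup p := h2 ▸ AddSubgroup.mem_top x
    induction hx using AddSubgroup.iSup_induction' with
    | hp i x hx =>
      exact ⟨DirectSum.of (fun i => p i) i ⟨x, hx⟩, DirectSum.coeAddMonoidHom_of _ _ _⟩
    | h1 => exact ⟨0, map_zero _⟩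
    | hadd x y _ _ hx hy =>
      obtain ⟨a, rfl⟩ := hx
      obtain ⟨b, rfl⟩ := hy
      exact ⟨a + b, map_add _ _ _⟩

theorem isInternal_shift {Γ M : Type*} [AddCommGroup Γ] [DecidableEq Γ] [AddCommGroup M]
    (p : Γ → AddSubgroup M) (h : DirectSum.IsInternal p) (α : Γ) :
    DirectSum.IsInternal (fun γ => p (α + γ)) := by
  rw [isInternal_iff] at h ⊢
  refine ⟨h.1.comp (add_right_injective α), ?_⟩
  rw [← h.2]
  exact (Equiv.addLeft α).iSup_comp (g := p)

section

variable {Γ : Type*} [AddCommGroup Γ] [DecidableEq Γ] {A : Type u} [Ring A]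
  {σ : Type*} [SetLike σ A] {𝒜 : Γ → σ}

/-- Graded homomorphisms: `A`-linear maps that preserve degrees. -/
@[ext]
structure Hom (M N : GrMod.{u, v} 𝒜) where
  toLinearMap : M.carrier →ₗ[Aᵐᵒᵖ] N.carrier
  map_mem : ∀ (i : Γ) (m : M.carrier), m ∈ M.piece i → toLinearMap m ∈ N.piece i

/-- The category `Gr-A` of graded right `A`-modules. -/
instance : Category (GrMod.{u, v} 𝒜) where
  Hom M N := Hom M N
  id M := ⟨LinearMap.id, fun _ _ h => h⟩
  comp f g := ⟨g.toLinearMap ∘ₗ f.toLinearMap, fun i m h => g.map_mem i _ (f.map_mem i m h)⟩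

/-- The shifted module `M(α)`, with `M(α)_γ = M_{α+γ}`. -/
def shift (α : Γ) (M : GrMod.{u, v} 𝒜) : GrMod.{u, v} 𝒜 where
  carrier := M.carrier
  piece γ := M.piece (α + γ)
  isInternal := isInternal_shift M.piece M.isInternal α
  op_smul_mem i j m a hm ha := by
    rw [← add_assoc]; exact M.op_smul_mem _ _ m a hm ha

/-- The shift functor `T_α : Gr-A ⥤ Gr-A`, the identity on the underlying maps. -/
def shiftFunctor (𝒜 : Γ → σ) (α : Γ) : GrMod.{u, v} 𝒜 ⥤ GrMod.{u, v} 𝒜 where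
  obj M := M.shift α
  map f := ⟨f.toLinearMap, fun i m h => f.map_mem (α + i) m h⟩

end

end GrMod

section GradedMorita

variable {Γ : Type*} [AddCommGroup Γ] [DecidableEq Γ] {A B : Type u} [Ring A] [Ring B]
  {σ τ : Type*} [SetLike σ A] [AddSubgroupClass σ A] [SetLike τ B] [AddSubgroupClass τ B]

/-- A functor between categories of graded modules is graded if it commutes with all shifts. -/
def IsGradedFunctor {𝒜 : Γ → σ} {ℬ : Γ → τ} (φ : GrMod.{u, u} 𝒜 ⥤ GrMod.{u, u} ℬ) : Prop :=
  ∀ α : Γ, GrMod.shiftFunctor 𝒜 α ⋙ φ = φ ⋙ GrMod.shiftFunctor ℬ α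

/-- Graded Morita equivalence of two `Γ`-graded rings: there are graded functors between the
categories of graded right modules which are inverse to each other up to natural isomorphism
(in the category of graded modules, so the components are graded isomorphisms). -/
def GradedMoritaEquivalent (𝒜 : Γ → σ) [GradedRing 𝒜] (ℬ : Γ → τ) [GradedRing ℬ] : Prop :=
  ∃ (φ : GrMod.{u, u} 𝒜 ⥤ GrMod.{u, u} ℬ) (ψ : GrMod.{u, u} ℬ ⥤ GrMod.{u, u} 𝒜),
    IsGradedFunctor φ ∧ IsGradedFunctor ψ ∧
      Nonempty (φ ⋙ ψ ≅ 𝟭 (GrMod.{u, u} 𝒜)) ∧ Nonempty (ψ ⋙ φ ≅ 𝟭 (GrMod.{u, u} ℬ))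

end GradedMorita

/-! ### Directed graphs and Leavitt path algebras -/

/-- A directed graph `(E⁰, E¹, r, s)` with vertex set `V` and edge set `E`; loops and multiple
edges are allowed. -/
structure DirGraph (V E : Type*) where
  src : E → V
  rng : E → V

namespace DirGraph

/-- No vertex is a sink. -/
def NoSinks {V E : Type*} (G : DirGraph V E) : Prop :=
  ∀ v : V, ∃ e : E, G.src e = v

/-- The generators of a Leavitt path algebra: vertices `v`, edges `α`, ghost edges `α*`. -/
inductive Gen (V E : Type*) where
  | vert (v : V) : Gen V E
  | edge (e : E) : Gen V E
  | ghost (e : E) : Gen V E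

section

variable (K : Type*) [Field K] {V E : Type*} [Fintype V] [Fintype E]

open FreeAlgebra in
open scoped Classical in
/-- The defining relations of the Leavitt path algebra of a finite graph. The first one says that
the sum of the vertices, which is an identity element of the algebra by `vert_mul_vert` and the
four relations after it, is the identity of the (unital) free algebra we start from. -/
inductive LeavittRel (G : DirGraph V E) :
    FreeAlgebra K (Gen V E) → FreeAlgebra K (Gen V E) → Prop
  | sum_vert : LeavittRel G (∑ v : V, ι K (.vert v)) 1
  | vert_mul_vert (v w : V) :
      LeavittRel G (ι K (.vert v) * ι K (.vert w)) (if v = w then ι K (.vert v) else 0)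
  | src_mul_edge (e : E) : LeavittRel G (ι K (.vert (G.src e)) * ι K (.edge e)) (ι K (.edge e))
  | edge_mul_rng (e : E) : LeavittRel G (ι K (.edge e) * ι K (.vert (G.rng e))) (ι K (.edge e))
  | rng_mul_ghost (e : E) :
      LeavittRel G (ι K (.vert (G.rng e)) * ι K (.ghost e)) (ι K (.ghost e))
  | ghost_mul_src (e : E) :
      LeavittRel G (ι K (.ghost e) * ι K (.vert (G.src e))) (ι K (.ghost e))
  | ghost_mul_edge (e f : E) :
      LeavittRel G (ι K (.ghost e) * ι K (.edge f)) (if e = f then ι K (.vert (G.rng e)) else 0)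
  | sum_edge_mul_ghost (v : V) (hv : ∃ e : E, G.src e = v) :
      LeavittRel G (∑ e : E with G.src e = v, ι K (.edge e) * ι K (.ghost e)) (ι K (.vert v))

/-- The Leavitt path algebra `L_K(G)` of a finite graph `G`. -/
def Leavitt (G : DirGraph V E) : Type _ := RingQuot (LeavittRel K G)

instance (G : DirGraph V E) : Ring (Leavitt K G) := inferInstanceAs (Ring (RingQuot _))

instance (G : DirGraph V E) : Algebra K (Leavitt K G) :=
  inferInstanceAs (Algebra K (RingQuot _))

namespace Leavitt

/-- The image of a generator in the Leavitt path algebra. -/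
def gen (G : DirGraph V E) (g : Gen V E) : Leavitt K G :=
  RingQuot.mkAlgHom K (LeavittRel K G) (FreeAlgebra.ι K g)

/-- The vertex `v` as an element of the Leavitt path algebra. -/
abbrev vert (G : DirGraph V E) (v : V) : Leavitt K G := gen K G (.vert v)

variable {Γ : Type*} [AddCommGroup Γ]

/-- The degree of a generator, for a weight map `w` on the edges. -/
def genDeg (w : E → Γ) : Gen V E → Γ
  | .vert _ => 0
  | .edge e => w e
  | .ghost e => -w e

/-- The homogeneous component of degree `γ` of the Leavitt path algebra, for the grading induced
by the weight map `w`: the span of the words of total degree `γ` in the generators. -/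
def grading (G : DirGraph V E) (w : E → Γ) (γ : Γ) : Submodule K (Leavitt K G) :=
  Submodule.span K {x | ∃ l : List (Gen V E),
    (l.map (genDeg w)).sum = γ ∧ (l.map (gen K G)).prod = x}

variable {K}

theorem gen_mem_grading (G : DirGraph V E) (w : E → Γ) (g : Gen V E) :
    gen K G g ∈ grading K G w (genDeg w g) :=
  Submodule.subset_span ⟨[g], by simp, by simp⟩

instance gradedMonoid (G : DirGraph V E) (w : E → Γ) :
    SetLike.GradedMonoid (grading K G w) where
  one_mem := Submodule.subset_span ⟨[], by simp, by simp⟩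
  mul_mem i j x y hx hy := by
    have h := Submodule.mul_mem_mul hx hy
    rw [grading, grading, Submodule.span_mul_span] at h
    refine Submodule.span_mono ?_ h
    rintro _ ⟨_, ⟨l, hl, rfl⟩, _, ⟨m, hm, rfl⟩, rfl⟩
    exact ⟨l ++ m, by simp [hl, hm], by simp⟩

variable [DecidableEq Γ]

theorem rel_eq {G : DirGraph V E} {a b : FreeAlgebra K (Gen V E)} (h : LeavittRel K G a b) :
    RingQuot.mkAlgHom K (LeavittRel K G) a = RingQuot.mkAlgHom K (LeavittRel K G) b :=
  RingQuot.mkAlgHom_rel K h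

open DirectSum in
/-- The map from the free algebra that sends each generator to its class, in its degree. -/
noncomputable def freeDecompose (G : DirGraph V E) (w : E → Γ) :
    FreeAlgebra K (Gen V E) →ₐ[K] ⨁ γ, grading K G w γ :=
  FreeAlgebra.lift K fun g =>
    DirectSum.of (fun γ => grading K G w γ) (genDeg w g) ⟨gen K G g, gen_mem_grading G w g⟩

theorem coe_freeDecompose (G : DirGraph V E) (w : E → Γ) (a : FreeAlgebra K (Gen V E)) :
    DirectSum.coeAlgHom (grading K G w) (freeDecompose G w a) =
      RingQuot.mkAlgHom K (LeavittRel K G) a := by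
  have : (DirectSum.coeAlgHom (grading K G w)).comp (freeDecompose G w) =
      RingQuot.mkAlgHom K (LeavittRel K G) := by
    ext g
    simp only [freeDecompose, AlgHom.coe_comp, Function.comp_apply, FreeAlgebra.lift_ι_apply,
      DirectSum.coeAlgHom_of]
    rfl
  exact DFunLike.congr_fun this a

/-- The elements of the free algebra whose image under `freeDecompose` is concentrated in
degree `γ`. -/
noncomputable def homog (K : Type*) [Field K] (G : DirGraph V E) (w : E → Γ) (γ : Γ) :
    AddSubmonoid (FreeAlgebra K (Gen V E)) :=
  (AddMonoidHom.mrange (DirectSum.of (fun γ => grading K G w γ) γ)).comap (freeDecompose G w)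

theorem ι_mem_homog (G : DirGraph V E) (w : E → Γ) (g : Gen V E) (γ : Γ) (h : genDeg w g = γ) :
    FreeAlgebra.ι K g ∈ homog K G w γ := by
  subst h
  exact ⟨⟨gen K G g, gen_mem_grading G w g⟩, by simp [freeDecompose]⟩

theorem mul_mem_homog {G : DirGraph V E} {w : E → Γ} {a b : FreeAlgebra K (Gen V E)} {i j : Γ}
    (γ : Γ) (ha : a ∈ homog K G w i) (hb : b ∈ homog K G w j) (h : i + j = γ) :
    a * b ∈ homog K G w γ := by
  subst h
  obtain ⟨x, hx⟩ := ha
  obtain ⟨y, hy⟩ := hb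
  refine ⟨GradedMonoid.GMul.mul (A := fun γ => grading K G w γ) x y, ?_⟩
  have hx' : freeDecompose G w a = _ := hx.symm
  have hy' : freeDecompose G w b = _ := hy.symm
  change _ = freeDecompose G w (a * b)
  rw [map_mul, hx', hy', DirectSum.of_mul_of]

theorem one_mem_homog (G : DirGraph V E) (w : E → Γ) :
    (1 : FreeAlgebra K (Gen V E)) ∈ homog K G w 0 :=
  ⟨GradedMonoid.GOne.one (A := fun γ => grading K G w γ), (map_one (freeDecompose G w)).symm⟩

theorem freeDecompose_eq {G : DirGraph V E} {w : E → Γ} {a b : FreeAlgebra K (Gen V E)} (γ : Γ)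
    (ha : a ∈ homog K G w γ) (hb : b ∈ homog K G w γ) (h : LeavittRel K G a b) :
    freeDecompose G w a = freeDecompose G w b := by
  obtain ⟨x, hx⟩ := ha
  obtain ⟨y, hy⟩ := hb
  replace hx : freeDecompose G w a = _ := hx.symm
  replace hy : freeDecompose G w b = _ := hy.symm
  have h1 := coe_freeDecompose G w a
  have h2 := coe_freeDecompose G w b
  rw [hx, DirectSum.coeAlgHom_of] at h1
  rw [hy, DirectSum.coeAlgHom_of] at h2
  rw [hx, hy]
  congr 1
  exact Subtype.ext (h1.trans ((rel_eq h).trans h2.symm))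

/-- The defining relations are homogeneous. -/
theorem freeDecompose_rel (G : DirGraph V E) (w : E → Γ) ⦃a b : FreeAlgebra K (Gen V E)⦄
    (h : LeavittRel K G a b) : freeDecompose G w a = freeDecompose G w b := by
  have hv : ∀ v : V, FreeAlgebra.ι K (.vert v) ∈ homog K G w 0 :=
    fun v => ι_mem_homog G w _ 0 rfl
  have he : ∀ e : E, FreeAlgebra.ι K (.edge e) ∈ homog K G w (w e) :=
    fun e => ι_mem_homog G w _ _ rfl
  have hg : ∀ e : E, FreeAlgebra.ι K (.ghost e) ∈ homog K G w (-w e) :=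
    fun e => ι_mem_homog G w _ _ rfl
  have h' := h
  cases h with
  | sum_vert => exact freeDecompose_eq 0 (sum_mem fun v _ => hv v) (one_mem_homog G w) h'
  | vert_mul_vert v v' =>
    refine freeDecompose_eq 0 (mul_mem_homog 0 (hv v) (hv v') (add_zero 0)) ?_ h'
    split
    exacts [hv v, zero_mem _]
  | src_mul_edge e =>
    exact freeDecompose_eq (w e) (mul_mem_homog _ (hv _) (he e) (zero_add _)) (he e) h'
  | edge_mul_rng e =>
    exact freeDecompose_eq (w e) (mul_mem_homog _ (he e) (hv _) (add_zero _)) (he e) h'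
  | rng_mul_ghost e =>
    exact freeDecompose_eq (-w e) (mul_mem_homog _ (hv _) (hg e) (zero_add _)) (hg e) h'
  | ghost_mul_src e =>
    exact freeDecompose_eq (-w e) (mul_mem_homog _ (hg e) (hv _) (add_zero _)) (hg e) h'
  | ghost_mul_edge e f =>
    by_cases hef : e = f
    · subst hef
      refine freeDecompose_eq 0 (mul_mem_homog 0 (hg e) (he e) (neg_add_cancel _)) ?_ h'
      split
      exacts [hv _, zero_mem _]
    · refine freeDecompose_eq (-w e + w f) (mul_mem_homog _ (hg e) (he f) rfl) ?_ h'
      rw [if_neg hef]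
      exact zero_mem _
  | sum_edge_mul_ghost v hs =>
    exact freeDecompose_eq 0
      (sum_mem fun e _ => mul_mem_homog 0 (he e) (hg e) (add_neg_cancel _)) (hv v) h'

open DirectSum in
/-- The decomposition of an element of the Leavitt path algebra into homogeneous components. -/
noncomputable def decompose (G : DirGraph V E) (w : E → Γ) :
    Leavitt K G →ₐ[K] ⨁ γ, grading K G w γ :=
  RingQuot.liftAlgHom K ⟨freeDecompose G w, freeDecompose_rel G w⟩

theorem decompose_mk (G : DirGraph V E) (w : E → Γ) (a : FreeAlgebra K (Gen V E)) :
    decompose G w (RingQuot.mkAlgHom K (LeavittRel K G) a) = freeDecompose G w a :=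
  RingQuot.liftAlgHom_mkAlgHom_apply K (freeDecompose G w) (freeDecompose_rel G w) a

theorem decompose_prod (G : DirGraph V E) (w : E → Γ) (l : List (Gen V E))
    (h : (l.map (gen K G)).prod ∈ grading K G w (l.map (genDeg w)).sum) :
    decompose G w (l.map (gen K G)).prod =
      DirectSum.of (fun γ => grading K G w γ) (l.map (genDeg w)).sum ⟨_, h⟩ := by
  have hl : (l.map (FreeAlgebra.ι K)).prod ∈ homog K G w (l.map (genDeg w)).sum := by
    clear h
    induction l with
    | nil => exact one_mem_homog G w
    | cons g l ih =>
      simp only [List.map_cons, List.prod_cons, List.sum_cons]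
      exact mul_mem_homog _ (ι_mem_homog G w g _ rfl) ih rfl
  have hm : RingQuot.mkAlgHom K (LeavittRel K G) (l.map (FreeAlgebra.ι K)).prod =
      (l.map (gen K G)).prod := by
    rw [map_list_prod, List.map_map]
    rfl
  obtain ⟨x, hx⟩ := hl
  replace hx : freeDecompose G w _ = _ := hx.symm
  have h1 := coe_freeDecompose G w (l.map (FreeAlgebra.ι K)).prod
  rw [hx, DirectSum.coeAlgHom_of, hm] at h1
  have h2 := decompose_mk G w (l.map (FreeAlgebra.ι K)).prod
  rw [hm, hx] at h2
  rw [h2]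
  congr 1
  exact Subtype.ext h1

/-- The Leavitt path algebra is a graded algebra. -/
noncomputable instance gradedAlgebra (G : DirGraph V E) (w : E → Γ) :
    GradedAlgebra (grading K G w) :=
  GradedAlgebra.ofAlgHom _ (decompose G w)
    (by
      refine RingQuot.ringQuot_ext' (S := K) (s := LeavittRel K G) _ _ ?_
      ext g
      change DirectSum.coeAlgHom (grading K G w) (decompose G w
        (RingQuot.mkAlgHom K (LeavittRel K G) (FreeAlgebra.ι K g))) = _
      rw [decompose_mk, coe_freeDecompose]
      rfl)
    (by
      rintro γ ⟨x, hx⟩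
      change decompose G w x = _
      induction hx using Submodule.span_induction with
      | mem x h =>
        obtain ⟨l, rfl, rfl⟩ := h
        exact decompose_prod G w l _
      | zero =>
        rw [map_zero]
        exact (map_zero (DirectSum.of (fun γ => grading K G w γ) γ)).symm
      | add x y hx hy h1 h2 =>
        rw [map_add, h1, h2, ← map_add]
        rfl
      | smul c x hx h1 =>
        rw [map_smul, h1]
        exact (map_smul (DirectSum.lof K Γ (fun γ => grading K G w γ) γ) c ⟨x, hx⟩).symm)

end Leavitt

end

/-- Elementary strong shift equivalence of `E₁` and `E₂` via `E₃` (Ashton, Bates). The vertex set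
of `E₃` is the disjoint union of those of `E₁` and `E₂` (through `vertexEquiv`), every edge of
`E₃` goes from one part to the other, and the edges of `Eᵢ` correspond bijectively, respecting
sources and ranges, to the paths of length two in `E₃` that start and end in the `i`-th part. -/
structure ElementarySSEVia {V₁ E₁ V₂ E₂ V₃ E₃ : Type*} (G₁ : DirGraph V₁ E₁)
    (G₂ : DirGraph V₂ E₂) (G₃ : DirGraph V₃ E₃) where
  vertexEquiv : V₁ ⊕ V₂ ≃ V₃
  edge_bipartite : ∀ e : E₃,
    (∃ (v : V₁) (w : V₂), G₃.src e = vertexEquiv (.inl v) ∧ G₃.rng e = vertexEquiv (.inr w)) ∨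
    (∃ (w : V₂) (v : V₁), G₃.src e = vertexEquiv (.inr w) ∧ G₃.rng e = vertexEquiv (.inl v))
  θ₁ : E₁ ≃ {p : E₃ × E₃ // G₃.rng p.1 = G₃.src p.2 ∧
    (∃ v, G₃.src p.1 = vertexEquiv (.inl v)) ∧ ∃ v, G₃.rng p.2 = vertexEquiv (.inl v)}
  src_θ₁ : ∀ e, G₃.src (θ₁ e).1.1 = vertexEquiv (.inl (G₁.src e))
  rng_θ₁ : ∀ e, G₃.rng (θ₁ e).1.2 = vertexEquiv (.inl (G₁.rng e))
  θ₂ : E₂ ≃ {p : E₃ × E₃ // G₃.rng p.1 = G₃.src p.2 ∧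
    (∃ v, G₃.src p.1 = vertexEquiv (.inr v)) ∧ ∃ v, G₃.rng p.2 = vertexEquiv (.inr v)}
  src_θ₂ : ∀ e, G₃.src (θ₂ e).1.1 = vertexEquiv (.inr (G₂.src e))
  rng_θ₂ : ∀ e, G₃.rng (θ₂ e).1.2 = vertexEquiv (.inr (G₂.rng e))

end DirGraph

/-! ### The group `(1/2)ℤ` and full corners -/

/-- The cyclic subgroup `(1/2)ℤ` of `ℚ` generated by `1/2`. -/
abbrev HalfInt : Type := AddSubgroup.zmultiples (1 / 2 : ℚ)

namespace HalfInt

/-- The element `1/2` of `(1/2)ℤ`. -/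
def half : HalfInt := ⟨1 / 2, AddSubgroup.mem_zmultiples _⟩

/-- The element `1` of `(1/2)ℤ`. -/
def one : HalfInt := ⟨1, ⟨2, by norm_num⟩⟩

end HalfInt

/-- The graded `K`-algebra `A` is isomorphic, as a graded `K`-algebra, to the corner `pBp` of the
graded `K`-algebra `B`, and `p` is a full homogeneous idempotent of degree `0`, that is,
`p ^ 2 = p` and `BpB = B`. The degree `γ` component of `pBp` is its intersection with that
of `B`. -/
def IsGradedFullCorner (K : Type*) [Field K] {Γ : Type*} [AddCommGroup Γ] [DecidableEq Γ]
    {A B : Type*} [Ring A] [Algebra K A] [Ring B] [Algebra K B]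
    (𝒜 : Γ → Submodule K A) [GradedAlgebra 𝒜] (ℬ : Γ → Submodule K B) [GradedAlgebra ℬ]
    (p : B) : Prop :=
  p ∈ ℬ 0 ∧ AddSubgroup.closure {x : B | ∃ a b : B, x = a * p * b} = ⊤ ∧
    ∃ (hp : IsIdempotentElem p) (f : A ≃+* hp.Corner),
      (∀ (c : K) (x : A), (f (c • x)).1 = c • (f x).1) ∧
      ∀ (γ : Γ) (x : A), x ∈ 𝒜 γ ↔ (f x).1 ∈ ℬ γ

/-! ### Direct sum decompositions -/

/-! Both `L(G₁)` and `L(G₂)` are full graded corners of `L(G₃)`, and a graded ring is graded Morita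
equivalent to each of its full graded corners. Transitivity through `L(G₃)` then gives the
equivalence.

Corners. Let `H = G₃`, let `G` be one of the two graphs and let `p ∈ L(H)` be the sum of its
vertices. Each edge of `G` is sent to the product of the two edges of its path, so weight `1/2` in
`H` becomes weight `1` in `G`. The relations of `G` follow from those of `H`, the last one by
summing in `H` twice, which is possible at every vertex because `H` has no sinks
(`leavittFamily_inclGen`). It remains to see that this map `incl` is a bijection onto `pL(H)p`.
Since every edge of `H` crosses between the two parts, `L(H)p` is the sum of `pL(H)p` and the `f
pL(H)p` over the edges `f` ending in `G`. So `L(H)` ought to act on pairs `(a, b)` that stand for `a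
+ ∑ f * incl (b f)`, by formulas that involve `L(G)` only. These formulas do satisfy the Leavitt
relations (`leavittFamily_actGen`), and by `rep_incl` and `toIdeal_rep` the first coordinate of `c •
(1, 0)` is a left inverse of `incl` whose image under `incl` is `pcp`. Fullness is the identity `1 =
p + ∑ f p f*` (`sum_edge_mul_idem_mul_ghost`).

Morita equivalence. Let `A = pCp` and `1 = ∑ x i * y i` with `x i ∈ Cp`, `y i ∈ pC` homogeneous of
opposite degrees. The inverse functors are `M ↦ Mp` and `N ↦ N ⊗ pC`. The left `A`-module `pC` is a
direct summand of `Aⁿ`, by `c ↦ (c * x i)` and `(a i) ↦ ∑ a i * y i`, so `N ⊗ pC` can be modelled by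
the vectors in `Nⁿ` fixed by the idempotent matrix `(y i * x j)`. In this model commutation with
shifts is an equality of functors, as the definition demands. -/

theorem iSupIndep_of_jointly_injective {Γ J X : Type*} [AddCommGroup X] {Y : J → Type*}
    [∀ j, AddCommGroup (Y j)] (P : Γ → AddSubgroup X) (Q : ∀ j, Γ → AddSubgroup (Y j))
    (φ : ∀ j, X →+ Y j) (hφ : ∀ x, (∀ j, φ j x = 0) → x = 0)
    (hP : ∀ j γ x, x ∈ P γ → φ j x ∈ Q j γ) (hQ : ∀ j, iSupIndep (Q j)) : iSupIndep P := by
  intro γ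
  rw [AddSubgroup.disjoint_def]
  intro x hx hx'
  refine hφ x fun j => ?_
  have hd := hQ j γ
  rw [AddSubgroup.disjoint_def] at hd
  refine hd (hP j γ x hx) ?_
  -- `φ j` carries the sum of the other components of `P` into that of `Q j`, so `φ j x` lies in two
  -- disjoint subgroups.
  have hle : (⨆ (δ) (_ : δ ≠ γ), P δ) ≤ (⨆ (δ) (_ : δ ≠ γ), Q j δ).comap (φ j) :=
    iSup₂_le fun δ hδ y hy =>
      (le_iSup₂ (f := fun δ (_ : δ ≠ γ) => Q j δ) δ hδ) (hP j δ y hy)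
  exact hle hx'

/-- The fixed points of a degree-preserving endomorphism inherit the decomposition. -/
theorem isInternal_fixedPoints {Γ X : Type*} [DecidableEq Γ] [AddCommGroup X]
    (P : Γ → AddSubgroup X) (hP : DirectSum.IsInternal P) (T : X →+ X)
    (hT : ∀ γ x, x ∈ P γ → T x ∈ P γ) (S : AddSubgroup X) (hS : ∀ x, x ∈ S ↔ T x = x) :
    DirectSum.IsInternal (fun γ => (P γ).comap S.subtype) := by
  classical
  rw [GrMod.isInternal_iff]
  constructor
  · exact iSupIndep_of_jointly_injective (J := Unit) _ (fun _ => P) (fun _ => S.subtype)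
      (fun x hx => Subtype.ext (hx ())) (fun _ _ _ h => h)
      (fun _ => ((GrMod.isInternal_iff P).1 hP).1)
  · let := hP.chooseDecomposition P
    -- An endomorphism that preserves degrees commutes with taking components, so the components of
    -- a fixed point are fixed points.
    have hcomm : ∀ (x : X) (i : Γ),
        ((DirectSum.decompose P (T x) i : P i) : X) = T (DirectSum.decompose P x i : P i) := by
      intro x i
      induction x using DirectSum.Decomposition.inductionOn P with
      | zero => simp
      | @homogeneous j m =>
        by_cases hij : j = i
        · subst hij
          rw [DirectSum.decompose_of_mem_same P (hT _ _ m.2),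
            DirectSum.decompose_of_mem_same P m.2]
        · rw [DirectSum.decompose_of_mem_ne P (hT _ _ m.2) hij,
            DirectSum.decompose_of_mem_ne P m.2 hij, map_zero]
      | add a b ha hb => simp [ha, hb]
    rw [eq_top_iff]
    rintro ⟨x, hx⟩ -
    have hxi : ∀ i, ((DirectSum.decompose P x i : P i) : X) ∈ S := by
      intro i
      rw [hS, ← hcomm, (hS x).1 hx]
    have hsum : (⟨x, hx⟩ : S) = ∑ i ∈ (DirectSum.decompose P x).support,
        (⟨(DirectSum.decompose P x i : P i), hxi i⟩ : S) := by
      apply Subtype.ext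
      rw [AddSubgroup.val_finsetSum]
      exact (DirectSum.sum_support_decompose P x).symm
    rw [hsum]
    exact sum_mem fun i _ => AddSubgroup.mem_iSup_of_mem i (DirectSum.decompose P x i).2

/-- The coordinate evaluations give independence, and the sum over the finitely many coordinates
gives spanning. The shifts `d i` will be the degrees of the elements `x i` of a corner. -/
theorem isInternal_pi {Γ I N : Type*} [AddCommGroup Γ] [DecidableEq Γ] [Fintype I]
    [AddCommGroup N] (P : Γ → AddSubgroup N) (hP : DirectSum.IsInternal P) (d : I → Γ) :
    DirectSum.IsInternal (fun γ => AddSubgroup.pi Set.univ fun i => P (γ + d i)) := by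
  classical
  have hsh : ∀ i, iSupIndep (fun γ => P (γ + d i)) ∧ (⨆ γ, P (γ + d i)) = ⊤ := by
    intro i
    rw [← GrMod.isInternal_iff]
    simpa only [add_comm] using GrMod.isInternal_shift P hP (d i)
  rw [GrMod.isInternal_iff]
  constructor
  · exact iSupIndep_of_jointly_injective (Y := fun _ : I => N) _ (fun i γ => P (γ + d i))
      (fun i => Pi.evalAddMonoidHom (fun _ => N) i) (fun x hx => funext hx)
      (fun j γ x hx => hx j (Set.mem_univ j)) (fun i => (hsh i).1)
  · rw [eq_top_iff]
    intro x _
    rw [← Finset.univ_sum_single x]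
    refine sum_mem fun i _ => ?_
    have hle : (⨆ γ, P (γ + d i)) ≤ (⨆ γ, AddSubgroup.pi Set.univ fun i => P (γ + d i)).comap
        (AddMonoidHom.single (fun _ : I => N) i) := by
      refine iSup_le fun γ y hy => AddSubgroup.mem_iSup_of_mem γ ?_
      intro j _
      by_cases hij : j = i
      · subst hij
        simpa using hy
      · simp [hij, zero_mem]
    exact hle (by rw [(hsh i).2]; trivial)

/-! ### Strict equality of graded modules and of their homomorphisms -/

namespace GrMod

section

variable {Γ : Type*} [AddCommGroup Γ] [DecidableEq Γ] {A : Type u} [Ring A]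
  {σ : Type*} [SetLike σ A] {𝒜 : Γ → σ}

theorem hom_ext {M N : GrMod.{u, v} 𝒜} {f g : M ⟶ N}
    (h : ∀ m, Hom.toLinearMap f m = Hom.toLinearMap g m) : f = g :=
  Hom.ext (LinearMap.ext h)

/-- Graded functors commute with shifts up to equality, so equalities of objects are unavoidable.
They stay harmless when carrier and module structure agree and only the families of pieces have to
be identified. -/
theorem mk_eq_mk {X : Type v} [AddCommGroup X] [Module Aᵐᵒᵖ X] {p q : Γ → AddSubgroup X}
    (hpq : p = q) (h₁ : DirectSum.IsInternal p) (h₂) (h₃ : DirectSum.IsInternal q) (h₄) :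
    (⟨X, p, h₁, h₂⟩ : GrMod.{u, v} 𝒜) = ⟨X, q, h₃, h₄⟩ := by
  subst hpq
  rfl

theorem hom_heq {X Y : Type v} [AddCommGroup X] [Module Aᵐᵒᵖ X] [AddCommGroup Y]
    [Module Aᵐᵒᵖ Y] {p q : Γ → AddSubgroup X} {p' q' : Γ → AddSubgroup Y}
    (hpq : p = q) (hpq' : p' = q') {h₁ : DirectSum.IsInternal p} {h₂}
    {h₃ : DirectSum.IsInternal q} {h₄} {h₁' : DirectSum.IsInternal p'} {h₂'}
    {h₃' : DirectSum.IsInternal q'} {h₄'}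
    (f : (⟨X, p, h₁, h₂⟩ : GrMod.{u, v} 𝒜) ⟶ ⟨Y, p', h₁', h₂'⟩)
    (g : (⟨X, q, h₃, h₄⟩ : GrMod.{u, v} 𝒜) ⟶ ⟨Y, q', h₃', h₄'⟩)
    (h : Hom.toLinearMap f = Hom.toLinearMap g) : HEq f g := by
  subst hpq hpq'
  exact heq_of_eq (Hom.ext h)

end

end GrMod

/-! ### Graded Morita equivalence from full graded corners -/

section

variable {Γ : Type*} [AddCommGroup Γ] [DecidableEq Γ] {A B C : Type u} [Ring A] [Ring B] [Ring C]
  {σ τ ρ : Type*} [SetLike σ A] [SetLike τ B] [SetLike ρ C]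

theorem IsGradedFunctor.comp {𝒜 : Γ → σ} {ℬ : Γ → τ} {𝒞 : Γ → ρ}
    {φ : GrMod.{u, u} 𝒜 ⥤ GrMod.{u, u} ℬ} {ψ : GrMod.{u, u} ℬ ⥤ GrMod.{u, u} 𝒞}
    (hφ : IsGradedFunctor φ) (hψ : IsGradedFunctor ψ) : IsGradedFunctor (φ ⋙ ψ) := by
  intro α
  rw [← Functor.assoc, hφ α, Functor.assoc, hψ α, Functor.assoc]

variable [AddSubgroupClass σ A] [AddSubgroupClass τ B] [AddSubgroupClass ρ C]

theorem GradedMoritaEquivalent.symm {𝒜 : Γ → σ} [GradedRing 𝒜] {ℬ : Γ → τ} [GradedRing ℬ]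
    (h : GradedMoritaEquivalent 𝒜 ℬ) : GradedMoritaEquivalent ℬ 𝒜 := by
  obtain ⟨φ, ψ, hφ, hψ, e₁, e₂⟩ := h
  exact ⟨ψ, φ, hψ, hφ, e₂, e₁⟩

theorem GradedMoritaEquivalent.trans {𝒜 : Γ → σ} [GradedRing 𝒜] {ℬ : Γ → τ} [GradedRing ℬ]
    {𝒞 : Γ → ρ} [GradedRing 𝒞] (h : GradedMoritaEquivalent 𝒜 ℬ)
    (h' : GradedMoritaEquivalent ℬ 𝒞) : GradedMoritaEquivalent 𝒜 𝒞 := by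
  obtain ⟨φ, ψ, hφ, hψ, ⟨e₁⟩, ⟨e₂⟩⟩ := h
  obtain ⟨φ', ψ', hφ', hψ', ⟨e₁'⟩, ⟨e₂'⟩⟩ := h'
  refine ⟨φ ⋙ φ', ψ' ⋙ ψ, hφ.comp hφ', hψ'.comp hψ, ⟨?_⟩, ⟨?_⟩⟩
  · exact Functor.isoWhiskerLeft φ (Functor.isoWhiskerRight e₁' ψ) ≪≫ e₁
  · exact Functor.isoWhiskerLeft ψ' (Functor.isoWhiskerRight e₂ φ') ≪≫ e₂'

end

/-- A realization of the graded ring `A` as a full graded corner `pCp` of the graded ring `C`: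
`p` is `incl 1`, the map `compress` is `c ↦ pcp` followed by the inverse of `incl`, and the
elements `x i ∈ Cp`, `y i ∈ pC` witness fullness of `p`. -/
structure GradedCorner {Γ : Type*} [AddCommGroup Γ] {A C : Type u} [Ring A] [Ring C]
    {σ ρ : Type*} [SetLike σ A] [SetLike ρ C] (𝒜 : Γ → σ) (𝒞 : Γ → ρ) where
  incl : A →ₙ+* C
  compress : C →+ A
  compress_incl : ∀ a, compress (incl a) = a
  incl_compress : ∀ c, incl (compress c) = incl 1 * c * incl 1
  incl_mem : ∀ {γ a}, a ∈ 𝒜 γ → incl a ∈ 𝒞 γ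
  compress_mem : ∀ {γ c}, c ∈ 𝒞 γ → compress c ∈ 𝒜 γ
  I : Type u
  [fintype : Fintype I]
  x : I → C
  y : I → C
  deg : I → Γ
  x_mem : ∀ i, x i ∈ 𝒞 (deg i)
  y_mem : ∀ i, y i ∈ 𝒞 (-deg i)
  x_mul : ∀ i, x i * incl 1 = x i
  mul_y : ∀ i, incl 1 * y i = y i
  sum_x_mul_y : ∑ i, x i * y i = 1

/-! ### Compression to a corner -/

namespace GradedCorner

attribute [instance] GradedCorner.fintype

variable {Γ : Type*} [AddCommGroup Γ] {A C : Type u} [Ring A] [Ring C]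
  {σ ρ : Type*} [SetLike σ A] [SetLike ρ C]
  {𝒜 : Γ → σ} {𝒞 : Γ → ρ} (D : GradedCorner 𝒜 𝒞)

theorem incl_injective : Function.Injective D.incl :=
  Function.LeftInverse.injective D.compress_incl

theorem incl_one_mul (a : A) : D.incl 1 * D.incl a = D.incl a := by rw [← map_mul, one_mul]

theorem incl_mul_one (a : A) : D.incl a * D.incl 1 = D.incl a := by rw [← map_mul, mul_one]

/-- With `p = incl 1`, this is `(pcp)(pc'p) = p(cpc')p`, read through the injective map `incl`.
Compression is multiplicative only after `p` is inserted. -/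
theorem compress_mul_compress (c c' : C) :
    D.compress c * D.compress c' = D.compress (c * D.incl 1 * c') := by
  apply D.incl_injective
  have h := D.incl_one_mul 1
  simp only [map_mul, D.incl_compress, mul_assoc]
  simp only [← mul_assoc (D.incl 1) (D.incl 1), h]

theorem compress_incl_mul (a : A) (c : C) :
    D.compress (D.incl a * c) = a * D.compress c := by
  conv_rhs => rw [← D.compress_incl a]
  rw [compress_mul_compress, incl_mul_one]

theorem compress_mul_incl (a : A) (c : C) :
    D.compress (c * D.incl a) = D.compress c * a := by
  conv_rhs => rw [← D.compress_incl a]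
  rw [compress_mul_compress, mul_assoc, incl_one_mul]

/-- The inserted `p` is absorbed by `x i`, and `∑ x i * y i = 1`. This makes `c ↦ (compress (y i * c
* x j))` multiplicative, and it is the source of most of the identities below. -/
theorem sum_compress_mul (c c' : C) :
    ∑ i, D.compress (c * D.x i) * D.compress (D.y i * c') = D.compress (c * c') := by
  simp only [compress_mul_compress]
  rw [← map_sum]
  congr 1
  have : ∀ i, c * D.x i * D.incl 1 * (D.y i * c') = c * (D.x i * D.y i) * c' := by
    intro i
    rw [mul_assoc c (D.x i), D.x_mul]
    simp only [mul_assoc]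
  simp only [this]
  rw [← Finset.sum_mul, ← Finset.mul_sum, D.sum_x_mul_y, mul_one]

/-! ### Induction `N ↦ N ⊗ pC` by idempotent matrices -/

section Action

variable (N : Type*) [AddCommGroup N] [Module Aᵐᵒᵖ N]

/-- Right multiplication of row vectors over a right `A`-module by the matrix
`(compress (y i * c * x j))`. -/
def act (c : C) : (D.I → N) →+ (D.I → N) where
  toFun n j := ∑ i, MulOpposite.op (D.compress (D.y i * c * D.x j)) • n i
  map_zero' := by ext; simp
  map_add' n n' := by ext; simp [Finset.sum_add_distrib]

theorem act_apply (c : C) (n : D.I → N) (j : D.I) :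
    D.act N c n j = ∑ i, MulOpposite.op (D.compress (D.y i * c * D.x j)) • n i := rfl

/-- Matrix multiplication. The unit of `C` need not act as the identity, only as an idempotent,
which is why its fixed vectors are taken afterwards. -/
theorem act_act (c c' : C) (n : D.I → N) : D.act N c' (D.act N c n) = D.act N (c * c') n := by
  ext j
  simp only [act_apply, Finset.smul_sum]
  rw [Finset.sum_comm]
  refine Finset.sum_congr rfl fun i _ => ?_
  simp only [smul_smul, ← MulOpposite.op_mul]
  rw [← Finset.sum_smul, ← Finset.op_sum]
  have := D.sum_compress_mul (D.y i * c) (c' * D.x j)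
  simp only [mul_assoc] at this ⊢
  rw [this]

theorem act_add (c c' : C) (n : D.I → N) : D.act N (c + c') n = D.act N c n + D.act N c' n := by
  ext j
  simp [act_apply, mul_add, add_mul, add_smul, Finset.sum_add_distrib]

theorem act_zero (n : D.I → N) : D.act N 0 n = 0 := by
  ext j
  simp [act_apply]

/-- The vectors fixed by the idempotent matrix `(compress (y i * x j))`. This is a model of
`N ⊗ pC`. -/
def inducedSubgroup : AddSubgroup (D.I → N) := (D.act N 1).eqLocus (AddMonoidHom.id _)

variable {N}

theorem mem_inducedSubgroup {n : D.I → N} : n ∈ D.inducedSubgroup N ↔ D.act N 1 n = n := Iff.rfl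

theorem act_mem (c : C) (n : D.I → N) : D.act N c n ∈ D.inducedSubgroup N := by
  rw [mem_inducedSubgroup, act_act, mul_one]

variable (N)

/-- The right `C`-module structure of the induced module. -/
@[reducible]
def inducedModule : Module Cᵐᵒᵖ (D.inducedSubgroup N) where
  smul c n := ⟨D.act N c.unop n.1, D.act_mem _ _⟩
  one_smul n := Subtype.ext n.2
  mul_smul _ _ _ := Subtype.ext (D.act_act N _ _ _).symm
  smul_zero c := Subtype.ext (map_zero (D.act N c.unop))
  smul_add c _ _ := Subtype.ext (map_add (D.act N c.unop) _ _)
  add_smul _ _ _ := Subtype.ext (D.act_add N _ _ _)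
  zero_smul _ := Subtype.ext (D.act_zero N _)

end Action

section Induce

variable [DecidableEq Γ] [AddSubgroupClass ρ C] [GradedRing 𝒞]

theorem one_mem_piece : (1 : C) ∈ 𝒞 0 := SetLike.GradedOne.one_mem

/-- The vector of `n ⊗ c` has coordinates `n * (c * x i)`, so its `i`-th degree exceeds the total
degree by `deg i`. The matrix entry `y i * c * x j` changes this excess from `deg i` to `deg j`. -/
theorem act_mem_pi {N : GrMod.{u, u} 𝒜} {c : C} {δ γ : Γ} (hc : c ∈ 𝒞 δ) {n : D.I → N.carrier}
    (hn : ∀ i, n i ∈ N.piece (γ + D.deg i)) (j : D.I) :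
    D.act N.carrier c n j ∈ N.piece (γ + δ + D.deg j) := by
  rw [act_apply]
  refine sum_mem fun i _ => ?_
  have h : D.y i * c * D.x j ∈ 𝒞 (-D.deg i + δ + D.deg j) :=
    SetLike.mul_mem_graded (SetLike.mul_mem_graded (D.y_mem i) hc) (D.x_mem j)
  have h' := N.op_smul_mem _ _ _ _ (hn i) (D.compress_mem h)
  convert h' using 2
  abel

/-- The graded right `C`-module induced from a graded right `A`-module. -/
def induceObj (N : GrMod.{u, u} 𝒜) : GrMod.{u, u} 𝒞 :=
  letI := D.inducedModule N.carrier
  { carrier := D.inducedSubgroup N.carrier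
    piece := fun γ => (AddSubgroup.pi Set.univ fun i => N.piece (γ + D.deg i)).comap
      (D.inducedSubgroup N.carrier).subtype
    isInternal := isInternal_fixedPoints _ (isInternal_pi N.piece N.isInternal D.deg)
      (D.act N.carrier 1)
      (fun γ n hn j _ => by
        have := D.act_mem_pi (one_mem_piece (𝒞 := 𝒞)) (fun i => hn i (Set.mem_univ i)) j
        rwa [add_zero] at this) _
      (fun _ => Iff.rfl)
    op_smul_mem := fun _ _ _ _ hn hc j _ =>
      D.act_mem_pi hc (fun i => hn i (Set.mem_univ i)) j }

/-- The functor from graded right `A`-modules to graded right `C`-modules, a model of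
`- ⊗ pC`. -/
def induce : GrMod.{u, u} 𝒜 ⥤ GrMod.{u, u} 𝒞 where
  obj := D.induceObj
  map {N N'} f :=
    letI := D.inducedModule N.carrier
    letI := D.inducedModule N'.carrier
    have h (c : C) (n : D.I → N.carrier) : D.act N'.carrier c (fun i => f.toLinearMap (n i)) =
        fun i => f.toLinearMap (D.act N.carrier c n i) := by
      ext j
      simp [act_apply]
    { toLinearMap :=
        { toFun := fun n : D.inducedSubgroup N.carrier =>
            (⟨fun i => f.toLinearMap (n.1 i), by
              rw [mem_inducedSubgroup, h, n.2]; rfl⟩ : D.inducedSubgroup N'.carrier)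
          map_add' := fun n n' => Subtype.ext (funext fun i => map_add f.toLinearMap _ _)
          map_smul' := fun c n => Subtype.ext (h c.unop n.1).symm }
      map_mem := fun γ n hn i _ => f.map_mem _ _ (hn i (Set.mem_univ i)) }

/-- The two composites have the same carriers and maps. Their pieces differ only in the bracketing
of `α + γ + deg i`. -/
theorem isGradedFunctor_induce : IsGradedFunctor D.induce := by
  intro α
  have hp : ∀ N : GrMod.{u, u} 𝒜, (fun γ => (AddSubgroup.pi Set.univ fun i =>
      N.piece (α + (γ + D.deg i))).comap (D.inducedSubgroup N.carrier).subtype) =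
      fun γ => (AddSubgroup.pi Set.univ fun i =>
      N.piece (α + γ + D.deg i)).comap (D.inducedSubgroup N.carrier).subtype := by
    intro N
    simp only [add_assoc]
  refine CategoryTheory.Functor.hext (fun N => ?_) (fun N N' f => ?_)
  · let := D.inducedModule N.carrier
    exact GrMod.mk_eq_mk (hp N) _ _ _ _
  · let := D.inducedModule N.carrier
    let := D.inducedModule N'.carrier
    exact GrMod.hom_heq (hp N) (hp N') _ _ rfl

end Induce

/-! ### Restriction `M ↦ Mp` -/

section Restrict

variable (M : Type*) [AddCommGroup M] [Module Cᵐᵒᵖ M]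

/-- The subgroup `Mp` of a right `C`-module `M`. -/
def restrictedSubgroup : AddSubgroup M :=
  (DistribSMul.toAddMonoidHom M (MulOpposite.op (D.incl 1))).eqLocus (AddMonoidHom.id _)

variable {M}

theorem mem_restrictedSubgroup {m : M} :
    m ∈ D.restrictedSubgroup M ↔ MulOpposite.op (D.incl 1) • m = m := Iff.rfl

theorem op_smul_mem_restricted {c : C} (hc : c * D.incl 1 = c) (m : M) :
    MulOpposite.op c • m ∈ D.restrictedSubgroup M := by
  rw [mem_restrictedSubgroup, smul_smul, ← MulOpposite.op_mul, hc]

variable (M)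

/-- The right `A`-module structure on `Mp`. -/
@[reducible]
def restrictedModule : Module Aᵐᵒᵖ (D.restrictedSubgroup M) where
  smul a m := ⟨MulOpposite.op (D.incl a.unop) • m.1,
    D.op_smul_mem_restricted (D.incl_mul_one _) _⟩
  one_smul m := Subtype.ext m.2
  mul_smul a a' m := Subtype.ext <| by
    change MulOpposite.op (D.incl (a * a').unop) • m.1 =
      MulOpposite.op (D.incl a.unop) • MulOpposite.op (D.incl a'.unop) • m.1
    rw [smul_smul, ← MulOpposite.op_mul, MulOpposite.unop_mul, map_mul]
  smul_zero _ := Subtype.ext (smul_zero _)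
  smul_add _ _ _ := Subtype.ext (smul_add _ _ _)
  add_smul a a' m := Subtype.ext <| by
    change MulOpposite.op (D.incl (a + a').unop) • m.1 =
      MulOpposite.op (D.incl a.unop) • m.1 + MulOpposite.op (D.incl a'.unop) • m.1
    rw [← add_smul, ← MulOpposite.op_add, MulOpposite.unop_add, map_add]
  zero_smul m := Subtype.ext <| by
    change MulOpposite.op (D.incl 0) • m.1 = 0
    rw [map_zero, MulOpposite.op_zero, zero_smul]

end Restrict

section

variable [DecidableEq Γ] [AddSubgroupClass σ A] [GradedRing 𝒜]

theorem incl_one_mem : D.incl 1 ∈ 𝒞 0 := D.incl_mem SetLike.GradedOne.one_mem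

/-- The graded right `A`-module `Mp` of a graded right `C`-module `M`. -/
def restrictObj (M : GrMod.{u, u} 𝒞) : GrMod.{u, u} 𝒜 :=
  letI := D.restrictedModule M.carrier
  { carrier := D.restrictedSubgroup M.carrier
    piece := fun γ => (M.piece γ).comap (D.restrictedSubgroup M.carrier).subtype
    isInternal := isInternal_fixedPoints _ M.isInternal
      (DistribSMul.toAddMonoidHom M.carrier (MulOpposite.op (D.incl 1)))
      (fun γ m hm => by
        have := M.op_smul_mem γ 0 m _ hm D.incl_one_mem
        rwa [add_zero] at this) _
      (fun _ => Iff.rfl)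
    op_smul_mem := fun _ _ _ _ hm ha => M.op_smul_mem _ _ _ _ hm (D.incl_mem ha) }

/-- The functor `M ↦ Mp` from graded right `C`-modules to graded right `A`-modules. -/
def restrict : GrMod.{u, u} 𝒞 ⥤ GrMod.{u, u} 𝒜 where
  obj := D.restrictObj
  map {M M'} f :=
    letI := D.restrictedModule M.carrier
    letI := D.restrictedModule M'.carrier
    { toLinearMap :=
        { toFun := fun m : D.restrictedSubgroup M.carrier =>
            (⟨f.toLinearMap m.1, by
              rw [mem_restrictedSubgroup, ← map_smul, D.mem_restrictedSubgroup.1 m.2]⟩ :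
              D.restrictedSubgroup M'.carrier)
          map_add' := fun m m' => Subtype.ext (map_add f.toLinearMap _ _)
          map_smul' := fun a m => Subtype.ext (map_smul f.toLinearMap _ _) }
      map_mem := fun γ m hm => f.map_mem _ _ hm }

theorem isGradedFunctor_restrict : IsGradedFunctor D.restrict := fun _ => rfl

end

/-! ### The two composites are isomorphic to the identity -/

section Units

variable (N : Type*) [AddCommGroup N] [Module Aᵐᵒᵖ N]

theorem compress_one : D.compress 1 = 1 := by
  apply D.incl_injective
  rw [D.incl_compress, mul_one, incl_one_mul]

/-- For `c' = 1` and `c = incl a` this is the `A`-linearity of `n ↦ ∑ n j * compress (y j)`, the map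
from `(N ⊗ pC)p` to `N`. -/
theorem sum_compress_smul_act (c c' : C) (n : D.I → N) :
    ∑ j, MulOpposite.op (D.compress (D.y j * c')) • D.act N c n j =
      ∑ i, MulOpposite.op (D.compress (D.y i * c * c')) • n i := by
  simp only [act_apply, Finset.smul_sum]
  rw [Finset.sum_comm]
  refine Finset.sum_congr rfl fun i _ => ?_
  simp only [smul_smul, ← MulOpposite.op_mul]
  rw [← Finset.sum_smul, ← Finset.op_sum, D.sum_compress_mul (D.y i * c) c']

/-- The vector acted on represents `m ⊗ p`, and the result represents `m ⊗ pc`. -/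
theorem act_row (c : C) (m : N) :
    D.act N c (fun i => MulOpposite.op (D.compress (D.x i)) • m) =
      fun j => MulOpposite.op (D.compress (c * D.x j)) • m := by
  ext j
  have := D.sum_compress_mul 1 (c * D.x j)
  simp only [one_mul] at this
  simp only [act_apply, smul_smul, ← MulOpposite.op_mul, mul_assoc]
  rw [← Finset.sum_smul, ← Finset.op_sum, this]

/-- The element already lies in `pCp`. Hence on vectors over `Mp` the matrix action can be computed
with scalars from `C`. -/
theorem incl_compress_y_mul_x (i j : D.I) (c : C) :
    D.incl (D.compress (D.y i * c * D.x j)) = D.y i * c * D.x j := by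
  rw [D.incl_compress, mul_assoc, mul_assoc, D.x_mul, ← mul_assoc, ← mul_assoc, D.mul_y]

variable (M : Type*) [AddCommGroup M] [Module Cᵐᵒᵖ M]

theorem coe_act_restricted (c : C) (m : D.I → D.restrictedSubgroup M) (j : D.I) :
    letI := D.restrictedModule M
    (D.act (D.restrictedSubgroup M) c m j).1 =
      ∑ i, MulOpposite.op (D.y i * c * D.x j) • (m i).1 := by
  let := D.restrictedModule M
  rw [act_apply, AddSubgroup.val_finsetSum]
  refine Finset.sum_congr rfl fun i _ => ?_
  change MulOpposite.op (D.incl _) • (m i).1 = _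
  rw [MulOpposite.unop_op, incl_compress_y_mul_x]

/-- This is the `C`-linearity of `m ↦ ∑ m i * y i`, the map from `Mp ⊗ pC` to `M`; the sum over `j`
collapses by `∑ x j * y j = 1`. -/
theorem sum_y_smul_act (c : C) (m : D.I → D.restrictedSubgroup M) :
    letI := D.restrictedModule M
    ∑ j, MulOpposite.op (D.y j) • (D.act (D.restrictedSubgroup M) c m j).1 =
      ∑ i, MulOpposite.op (D.y i * c) • (m i).1 := by
  let := D.restrictedModule M
  simp only [coe_act_restricted, Finset.smul_sum, smul_smul, ← MulOpposite.op_mul]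
  rw [Finset.sum_comm]
  refine Finset.sum_congr rfl fun i _ => ?_
  rw [← Finset.sum_smul, ← Finset.op_sum]
  simp only [mul_assoc _ (D.x _) (D.y _)]
  rw [← Finset.mul_sum, D.sum_x_mul_y, mul_one]

/-- The vector `(m x j)` in `(Mp)ⁿ`. -/
def row (m : M) (j : D.I) : D.restrictedSubgroup M :=
  ⟨MulOpposite.op (D.x j) • m, D.op_smul_mem_restricted (D.x_mul j) m⟩

theorem coe_act_row (c : C) (m : M) (j : D.I) :
    letI := D.restrictedModule M
    (D.act (D.restrictedSubgroup M) c (D.row M m) j).1 = MulOpposite.op (c * D.x j) • m := by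
  let := D.restrictedModule M
  simp only [coe_act_restricted, row, smul_smul, ← MulOpposite.op_mul]
  rw [← Finset.sum_smul, ← Finset.op_sum]
  simp only [← mul_assoc]
  rw [← Finset.sum_mul, ← Finset.sum_mul, D.sum_x_mul_y, one_mul]

end Units

section

variable [DecidableEq Γ] [AddSubgroupClass σ A] [GradedRing 𝒜] [AddSubgroupClass ρ C]
  [GradedRing 𝒞]

/-- `(N ⊗ pC)p ≅ N`. -/
def induceRestrictIso (N : GrMod.{u, u} 𝒜) : D.restrictObj (D.induceObj N) ≅ N where
  hom :=
    { toLinearMap :=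
        { toFun := fun n => ∑ i, MulOpposite.op (D.compress (D.y i)) • n.1.1 i
          map_add' := fun n n' => by
            rw [← Finset.sum_add_distrib]
            exact Finset.sum_congr rfl fun i _ => smul_add _ _ _
          map_smul' := fun a n => by
            have := D.sum_compress_smul_act N.carrier (D.incl a.unop) 1 n.1.1
            simp only [mul_one] at this
            refine this.trans ?_
            rw [RingHom.id_apply, Finset.smul_sum]
            refine Finset.sum_congr rfl fun i _ => ?_
            rw [compress_mul_incl, MulOpposite.op_mul, mul_smul, MulOpposite.op_unop] }
      map_mem := fun γ n hn => sum_mem fun i _ => by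
        have := N.op_smul_mem _ _ _ _ (hn i (Set.mem_univ i)) (D.compress_mem (D.y_mem i))
        rwa [add_neg_cancel_right] at this }
  inv :=
    { toLinearMap :=
        { toFun := fun m =>
            (⟨(⟨fun j => MulOpposite.op (D.compress (D.x j)) • m, by
                rw [mem_inducedSubgroup, act_row]
                simp only [one_mul]⟩ : D.inducedSubgroup N.carrier),
              Subtype.ext <| (D.act_row N.carrier (D.incl 1) m).trans <| by
                simp only [compress_incl_mul, one_mul]
                rfl⟩ :
                D.restrictedSubgroup (D.induceObj N).carrier)
          map_add' := fun m m' => Subtype.ext (Subtype.ext (funext fun j => smul_add _ _ _))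
          map_smul' := fun a m => Subtype.ext <| Subtype.ext <|
            Eq.trans (funext fun j => by
              change MulOpposite.op (D.compress (D.x j)) • a • m = _
              rw [compress_incl_mul, MulOpposite.op_mul, mul_smul, MulOpposite.op_unop])
              (D.act_row N.carrier (D.incl a.unop) m).symm }
      map_mem := fun γ m hm j _ => N.op_smul_mem _ _ _ _ hm (D.compress_mem (D.x_mem j)) }
  hom_inv_id := GrMod.hom_ext fun n => Subtype.ext <| Subtype.ext <| by
    -- The composite is the action of `p`, since `compress (y i) * compress (x j)` is the matrix
    -- entry of `p`; and `n.2` says that `p` fixes `n`.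
    refine Eq.trans (funext fun j => ?_) (congrArg Subtype.val n.2)
    change MulOpposite.op (D.compress (D.x j)) •
      (∑ i, MulOpposite.op (D.compress (D.y i)) • n.1.1 i) =
      D.act N.carrier (D.incl 1) n.1.1 j
    simp only [act_apply, Finset.smul_sum, smul_smul, ← MulOpposite.op_mul,
      compress_mul_compress]
  inv_hom_id := GrMod.hom_ext fun m => by
    change ∑ i, MulOpposite.op (D.compress (D.y i)) • MulOpposite.op (D.compress (D.x i)) • m = m
    have := D.sum_compress_mul 1 1
    simp only [mul_one, one_mul, compress_one] at this
    simp only [smul_smul, ← MulOpposite.op_mul]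
    rw [← Finset.sum_smul, ← Finset.op_sum, this, MulOpposite.op_one, one_smul]

/-- `Mp ⊗ pC ≅ M`. -/
def restrictInduceIso (M : GrMod.{u, u} 𝒞) : D.induceObj (D.restrictObj M) ≅ M where
  hom :=
    { toLinearMap :=
        { toFun := fun m => ∑ i, MulOpposite.op (D.y i) • (m.1 i).1
          map_add' := fun m m' => by
            rw [← Finset.sum_add_distrib]
            exact Finset.sum_congr rfl fun i _ => smul_add _ _ _
          map_smul' := fun c m => by
            refine (D.sum_y_smul_act M.carrier c.unop m.1).trans ?_
            rw [RingHom.id_apply, Finset.smul_sum]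
            refine Finset.sum_congr rfl fun i _ => ?_
            rw [MulOpposite.op_mul, mul_smul, MulOpposite.op_unop] }
      map_mem := fun γ m hm => sum_mem fun i _ => by
        have := M.op_smul_mem _ _ _ _ (hm i (Set.mem_univ i)) (D.y_mem i)
        rwa [add_neg_cancel_right] at this }
  inv :=
    { toLinearMap :=
        { toFun := fun m =>
            (⟨D.row M.carrier m, funext fun j => Subtype.ext <|
                (D.coe_act_row M.carrier 1 m j).trans <| by rw [one_mul]; rfl⟩ :
              D.inducedSubgroup (D.restrictObj M).carrier)
          map_add' := fun m m' => Subtype.ext (funext fun j => Subtype.ext (smul_add _ _ _))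
          map_smul' := fun c m => Subtype.ext <| funext fun j => Subtype.ext <|
            Eq.trans (by
              change MulOpposite.op (D.x j) • c • m = MulOpposite.op (c.unop * D.x j) • m
              rw [MulOpposite.op_mul, mul_smul, MulOpposite.op_unop])
              (D.coe_act_row M.carrier c.unop m j).symm }
      map_mem := fun γ m hm j _ => M.op_smul_mem _ _ _ _ hm (D.x_mem j) }
  hom_inv_id := GrMod.hom_ext fun m => Subtype.ext <| funext fun j => Subtype.ext <| by
    -- Here the composite is the matrix of `1`, which fixes the vectors of the induced module by
    -- definition.
    refine Eq.trans ?_ (congrArg (fun n => (n j).1) m.2)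
    refine Eq.trans ?_ (D.coe_act_restricted M.carrier 1 m.1 j).symm
    change MulOpposite.op (D.x j) • (∑ i, MulOpposite.op (D.y i) • (m.1 i).1) = _
    simp only [Finset.smul_sum, smul_smul, ← MulOpposite.op_mul, mul_one]
  inv_hom_id := GrMod.hom_ext fun m => by
    change ∑ i, MulOpposite.op (D.y i) • MulOpposite.op (D.x i) • m = m
    simp only [smul_smul, ← MulOpposite.op_mul]
    rw [← Finset.sum_smul, ← Finset.op_sum, D.sum_x_mul_y, MulOpposite.op_one, one_smul]

/-- A graded ring is graded Morita equivalent to each of its full graded corners. -/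
theorem gradedMoritaEquivalent (D : GradedCorner 𝒜 𝒞) : GradedMoritaEquivalent 𝒜 𝒞 :=
  ⟨D.induce, D.restrict, D.isGradedFunctor_induce, D.isGradedFunctor_restrict,
    ⟨NatIso.ofComponents D.induceRestrictIso fun {N N'} f => GrMod.hom_ext fun n => by
      change ∑ i, MulOpposite.op (D.compress (D.y i)) • f.toLinearMap (n.1.1 i) =
        f.toLinearMap (∑ i, MulOpposite.op (D.compress (D.y i)) • n.1.1 i)
      simp only [map_sum, map_smul]⟩,
    ⟨NatIso.ofComponents D.restrictInduceIso fun {M M'} f => GrMod.hom_ext fun m => by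
      change ∑ i, MulOpposite.op (D.y i) • f.toLinearMap (m.1 i).1 =
        f.toLinearMap (∑ i, MulOpposite.op (D.y i) • (m.1 i).1)
      simp only [map_sum, map_smul]⟩⟩

end

end GradedCorner

/-! ### Homomorphisms out of Leavitt path algebras -/

/-- The corner of an algebra at an idempotent is an algebra. -/
@[reducible]
def IsIdempotentElem.cornerAlgebra {K B : Type*} [CommSemiring K] [Ring B] [Algebra K B] {p : B}
    (hp : IsIdempotentElem p) : Algebra K hp.Corner where
  smul c x := ⟨c • x.1, by
    obtain ⟨r, hr⟩ := x.2
    exact ⟨c • r, by simp only [← hr, mul_smul_comm, smul_mul_assoc]⟩⟩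
  algebraMap :=
    { toFun := fun c => ⟨c • p, c • p, by
        simp only [mul_smul_comm, smul_mul_assoc, hp.eq]⟩
      map_one' := Subtype.ext (one_smul K p)
      map_mul' := fun c d => Subtype.ext <| by
        change (c * d) • p = (c • p) * (d • p)
        rw [smul_mul_smul_comm, hp.eq]
      map_zero' := Subtype.ext (zero_smul K p)
      map_add' := fun c d => Subtype.ext (add_smul c d p) }
  commutes' c x := Subtype.ext <| by
    obtain ⟨h₁, h₂⟩ := (Subsemigroup.mem_corner_iff hp).1 x.2
    change (c • p) * x.1 = x.1 * (c • p)
    rw [smul_mul_assoc, mul_smul_comm, h₁, h₂]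
  smul_def' c x := Subtype.ext <| by
    obtain ⟨h₁, -⟩ := (Subsemigroup.mem_corner_iff hp).1 x.2
    change c • x.1 = (c • p) * x.1
    rw [smul_mul_assoc, h₁]

namespace DirGraph

variable {V E : Type*} [Fintype V] [Fintype E]

open scoped Classical in
/-- A family of elements indexed by the generators of a Leavitt path algebra that satisfies all the
defining relations except that the sum of the vertices need not be the identity. -/
structure LeavittFamily (G : DirGraph V E) {B : Type*} [Ring B] (φ : Gen V E → B) : Prop where
  vert_mul_vert (v w : V) : φ (.vert v) * φ (.vert w) = if v = w then φ (.vert v) else 0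
  src_mul_edge (e : E) : φ (.vert (G.src e)) * φ (.edge e) = φ (.edge e)
  edge_mul_rng (e : E) : φ (.edge e) * φ (.vert (G.rng e)) = φ (.edge e)
  rng_mul_ghost (e : E) : φ (.vert (G.rng e)) * φ (.ghost e) = φ (.ghost e)
  ghost_mul_src (e : E) : φ (.ghost e) * φ (.vert (G.src e)) = φ (.ghost e)
  ghost_mul_edge (e f : E) :
    φ (.ghost e) * φ (.edge f) = if e = f then φ (.vert (G.rng e)) else 0
  sum_edge_mul_ghost (v : V) (hv : ∃ e : E, G.src e = v) :
    ∑ e : E with G.src e = v, φ (.edge e) * φ (.ghost e) = φ (.vert v)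

namespace Leavitt

variable (K : Type*) [Field K] (G : DirGraph V E)

/-- The quotient map from the free algebra to the Leavitt path algebra. -/
def mk : FreeAlgebra K (Gen V E) →ₐ[K] Leavitt K G := RingQuot.mkAlgHom K (LeavittRel K G)

theorem mk_ι (g : Gen V E) : mk K G (FreeAlgebra.ι K g) = gen K G g := rfl

variable {K G} in
theorem mk_eq_mk {a b : FreeAlgebra K (Gen V E)} (h : LeavittRel K G a b) :
    mk K G a = mk K G b := RingQuot.mkAlgHom_rel K h

theorem sum_vert : ∑ v, vert K G v = 1 := by
  simpa only [map_sum, mk_ι, map_one] using mk_eq_mk (LeavittRel.sum_vert (K := K) (G := G))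

theorem leavittFamily_gen : LeavittFamily G (gen K G) where
  vert_mul_vert v w := by
    simpa only [map_mul, mk_ι, apply_ite (mk K G), map_zero] using
      mk_eq_mk (LeavittRel.vert_mul_vert (K := K) (G := G) v w)
  src_mul_edge e := by
    simpa only [map_mul, mk_ι] using mk_eq_mk (LeavittRel.src_mul_edge (K := K) (G := G) e)
  edge_mul_rng e := by
    simpa only [map_mul, mk_ι] using mk_eq_mk (LeavittRel.edge_mul_rng (K := K) (G := G) e)
  rng_mul_ghost e := by
    simpa only [map_mul, mk_ι] using mk_eq_mk (LeavittRel.rng_mul_ghost (K := K) (G := G) e)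
  ghost_mul_src e := by
    simpa only [map_mul, mk_ι] using mk_eq_mk (LeavittRel.ghost_mul_src (K := K) (G := G) e)
  ghost_mul_edge e f := by
    simpa only [map_mul, mk_ι, apply_ite (mk K G), map_zero] using
      mk_eq_mk (LeavittRel.ghost_mul_edge (K := K) (G := G) e f)
  sum_edge_mul_ghost v hv := by
    simpa only [map_mul, mk_ι, map_sum] using
      mk_eq_mk (LeavittRel.sum_edge_mul_ghost (K := K) (G := G) v hv)

variable {K G}

-- Scalars need no case of their own, because `1` is the sum of the vertices. This suits maps that
-- are not unital.
@[elab_as_elim]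
theorem induction {P : Leavitt K G → Prop} (zero : P 0) (gen : ∀ g, P (gen K G g))
    (smul : ∀ (k : K) a, P a → P (k • a)) (mul : ∀ a b, P a → P b → P (a * b))
    (add : ∀ a b, P a → P b → P (a + b)) (a : Leavitt K G) : P a := by
  obtain ⟨a, rfl⟩ : ∃ b, mk K G b = a := RingQuot.mkAlgHom_surjective K (LeavittRel K G) a
  induction a using FreeAlgebra.induction with
  | grade0 k =>
    rw [AlgHom.commutes, Algebra.algebraMap_eq_smul_one, ← sum_vert]
    exact smul _ _ (Finset.sum_induction _ P add zero fun v _ => gen _)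
  | grade1 g => exact gen g
  | mul a b ha hb => rw [map_mul]; exact mul _ _ ha hb
  | add a b ha hb => rw [map_add]; exact add _ _ ha hb

/-- A non-unital form of the universal property of the Leavitt path algebra. -/
theorem exists_lift {B : Type*} [Ring B] [Algebra K B] {φ : Gen V E → B}
    (hφ : LeavittFamily G φ) : ∃ F : Leavitt K G →ₙₐ[K] B, ∀ g, F (gen K G g) = φ g := by
  classical
  -- The element `q` is a two-sided identity for the whole family, so the family lives in the corner
  -- `qBq`. There `q` is the unit, the missing relation holds, and the unital universal property
  -- applies.
  set q := ∑ v, φ (.vert v) with hq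
  have hqv (v : V) : q * φ (.vert v) = φ (.vert v) := by
    simp [hq, Finset.sum_mul, hφ.vert_mul_vert]
  have hvq (v : V) : φ (.vert v) * q = φ (.vert v) := by
    simp [hq, Finset.mul_sum, hφ.vert_mul_vert]
  have hp : IsIdempotentElem q := by
    change q * q = q
    conv_lhs => rw [hq, Finset.sum_mul]
    simp only [← hq, hvq]
  have hl (g) : q * φ g = φ g := by
    cases g with
    | vert v => exact hqv v
    | edge e => rw [← hφ.src_mul_edge, ← mul_assoc, hqv]
    | ghost e => rw [← hφ.rng_mul_ghost, ← mul_assoc, hqv]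
  have hr (g) : φ g * q = φ g := by
    cases g with
    | vert v => exact hvq v
    | edge e => rw [← hφ.edge_mul_rng, mul_assoc, hvq]
    | ghost e => rw [← hφ.ghost_mul_src, mul_assoc, hvq]
  let := hp.cornerAlgebra (K := K)
  let val : hp.Corner →+ B :=
    { toFun := Subtype.val
      map_zero' := rfl
      map_add' := fun _ _ => rfl }
  let ψ (g : Gen V E) : hp.Corner := ⟨φ g, φ g, by simp only [hl, hr]⟩
  let F₀ : FreeAlgebra K (Gen V E) →ₐ[K] hp.Corner := FreeAlgebra.lift K ψ
  have hF₀ (g) : F₀ (FreeAlgebra.ι K g) = ψ g := FreeAlgebra.lift_ι_apply _ _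
  have hval {x y : hp.Corner} (h : val x = val y) : x = y := Subtype.ext h
  have hmul (x y : hp.Corner) : val (x * y) = val x * val y := rfl
  have hψ (g) : val (ψ g) = φ g := rfl
  have hF : ∀ ⦃a b⦄, LeavittRel K G a b → F₀ a = F₀ b := by
    intro a b h
    apply hval
    cases h with
    | sum_vert =>
      simp only [map_sum, hF₀, hψ, map_one]
      rfl
    | vert_mul_vert v w =>
      simp only [map_mul, hF₀, hmul, hψ, apply_ite F₀, apply_ite val, map_zero, hφ.vert_mul_vert]
    | src_mul_edge e => simp only [map_mul, hF₀, hmul, hψ, hφ.src_mul_edge]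
    | edge_mul_rng e => simp only [map_mul, hF₀, hmul, hψ, hφ.edge_mul_rng]
    | rng_mul_ghost e => simp only [map_mul, hF₀, hmul, hψ, hφ.rng_mul_ghost]
    | ghost_mul_src e => simp only [map_mul, hF₀, hmul, hψ, hφ.ghost_mul_src]
    | ghost_mul_edge e f =>
      simp only [map_mul, hF₀, hmul, hψ, apply_ite F₀, apply_ite val, map_zero, hφ.ghost_mul_edge]
    | sum_edge_mul_ghost v hv =>
      simp only [map_sum, map_mul, hF₀, hmul, hψ, hφ.sum_edge_mul_ghost v hv]
  let F₁ : Leavitt K G →ₐ[K] hp.Corner := RingQuot.liftAlgHom K ⟨F₀, hF⟩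
  have hF₁ (g) : F₁ (gen K G g) = ψ g :=
    (RingQuot.liftAlgHom_mkAlgHom_apply K F₀ hF (FreeAlgebra.ι K g)).trans (hF₀ g)
  refine ⟨{ toFun := fun a => val (F₁ a)
            map_zero' := by rw [map_zero, map_zero]
            map_add' := fun a b => by rw [map_add, map_add]
            map_mul' := fun a b => by rw [map_mul, hmul]
            map_smul' := fun k a => by rw [map_smul]; rfl }, fun g => ?_⟩
  exact congrArg val (hF₁ g)

theorem lift_mem_of_mem_grading {Γ : Type*} [AddCommGroup Γ] {B : Type*} [Ring B] [Algebra K B]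
    (ℬ : Γ → Submodule K B) [SetLike.GradedMonoid ℬ] (F : Leavitt K G →ₙₐ[K] B) (w : E → Γ)
    (hF : ∀ g, F (gen K G g) ∈ ℬ (genDeg w g)) {γ : Γ} {a : Leavitt K G}
    (ha : a ∈ grading K G w γ) : F a ∈ ℬ γ := by
  induction ha using Submodule.span_induction with
  | mem x h =>
    obtain ⟨l, rfl, rfl⟩ := h
    induction l with
    | nil =>
      -- `F` need not preserve `1`, so the empty word is rewritten as the sum of the vertices.
      change F 1 ∈ ℬ 0
      rw [← sum_vert, map_sum]
      exact sum_mem fun v _ => hF (.vert v)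
    | cons g l ih =>
      simp only [List.map_cons, List.prod_cons, List.sum_cons, map_mul]
      exact SetLike.mul_mem_graded (hF g) ih
  | zero => rw [map_zero]; exact zero_mem _
  | add x y _ _ hx hy => rw [map_add]; exact add_mem hx hy
  | smul k x _ hx => rw [map_smul]; exact Submodule.smul_mem _ _ hx

end Leavitt

end DirGraph

/-- An injective degree-preserving map reflects degrees. -/
theorem mem_of_map_mem {Γ A B σ τ : Type*} [DecidableEq Γ] [AddCommMonoid A] [AddCommMonoid B]
    [SetLike σ A] [AddSubmonoidClass σ A] [SetLike τ B] [AddSubmonoidClass τ B]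
    (𝒜 : Γ → σ) (ℬ : Γ → τ) [DirectSum.Decomposition 𝒜] [DirectSum.Decomposition ℬ]
    (f : A →+ B) (hf : Function.Injective f) (hmem : ∀ γ a, a ∈ 𝒜 γ → f a ∈ ℬ γ)
    {γ : Γ} {a : A} (ha : f a ∈ ℬ γ) : a ∈ 𝒜 γ := by
  classical
  -- Since `f` commutes with taking components, injectivity kills the components of `a` outside
  -- degree `γ`.
  have hcomm (x : A) (i : Γ) : (DirectSum.decompose ℬ (f x) i : B) =
      f (DirectSum.decompose 𝒜 x i) := by
    induction x using DirectSum.Decomposition.inductionOn 𝒜 with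
    | zero => simp
    | @homogeneous j m =>
      by_cases hij : j = i
      · subst hij
        rw [DirectSum.decompose_of_mem_same ℬ (hmem _ _ m.2),
          DirectSum.decompose_of_mem_same 𝒜 m.2]
      · rw [DirectSum.decompose_of_mem_ne ℬ (hmem _ _ m.2) hij,
          DirectSum.decompose_of_mem_ne 𝒜 m.2 hij, map_zero]
    | add a b ha hb => simp [ha, hb]
  have h0 (i : Γ) (hi : i ≠ γ) : (DirectSum.decompose 𝒜 a i : A) = 0 := by
    apply hf
    rw [← hcomm, DirectSum.decompose_of_mem_ne ℬ ha hi.symm, map_zero]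
  rw [← DirectSum.sum_support_decompose 𝒜 a]
  refine sum_mem fun i _ => ?_
  by_cases hi : i = γ
  · subst hi
    exact SetLike.coe_mem _
  · rw [h0 i hi]
    exact zero_mem _

/-! ### Graphs whose edges are the paths of length two in a bipartite graph -/

namespace DirGraph

/-- The edges of `G` are the paths of length two in the graph `H` that start and end in the set of
vertices `emb '' V`, and every edge of `H` crosses between this set and its complement. -/
structure PathEmbedding {V E W F : Type*} (G : DirGraph V E) (H : DirGraph W F) where
  emb : V → W
  emb_injective : Function.Injective emb
  src_iff : ∀ e, (∃ v, H.src e = emb v) ↔ ¬ ∃ v, H.rng e = emb v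
  θ : E ≃ {p : F × F // H.rng p.1 = H.src p.2 ∧
    (∃ v, H.src p.1 = emb v) ∧ ∃ v, H.rng p.2 = emb v}
  src_θ : ∀ e, H.src (θ e).1.1 = emb (G.src e)
  rng_θ : ∀ e, H.rng (θ e).1.2 = emb (G.rng e)

namespace PathEmbedding

set_option linter.unusedSectionVars false

open Leavitt

variable {K : Type*} [Field K] {V E W F : Type*} [Fintype V] [Fintype E] [Fintype W] [Fintype F]
  {G : DirGraph V E} {H : DirGraph W F} (T : PathEmbedding G H)

/-- An edge that starts in `G` ends outside it, so the next edge starts outside and must end in `G`.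
The condition on the end of the path is therefore automatic. -/
theorem exists_θ {e f : F} {v : V} (hef : H.rng e = H.src f) (he : H.src e = T.emb v) :
    ∃ ε, (T.θ ε).1 = (e, f) ∧ G.src ε = v := by
  have hf : ∃ v, H.rng f = T.emb v := by
    by_contra hf
    rw [← T.src_iff, ← hef] at hf
    exact (T.src_iff e).1 ⟨v, he⟩ hf
  obtain ⟨ε, hε⟩ := T.θ.surjective ⟨(e, f), hef, ⟨v, he⟩, hf⟩
  refine ⟨ε, by rw [hε], T.emb_injective ?_⟩
  rw [← T.src_θ, hε, he]

theorem θ_inj {ε ε' : E} (h₁ : (T.θ ε).1.1 = (T.θ ε').1.1) (h₂ : (T.θ ε).1.2 = (T.θ ε').1.2) :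
    ε = ε' :=
  T.θ.injective (Subtype.ext (Prod.ext h₁ h₂))

theorem rng_fst (ε : E) : H.rng (T.θ ε).1.1 = H.src (T.θ ε).1.2 := (T.θ ε).2.1

-- By `exists_θ`, the edges of `G` out of `v` are all the pairs of composable edges of `H` that
-- start at `v`. This splits the summation relation of `G` at `v` into two nested ones in `H`.
open scoped Classical in
theorem sum_θ {M : Type*} [AddCommMonoid M] (v : V) (m : F → F → M) :
    ∑ ε with G.src ε = v, m (T.θ ε).1.1 (T.θ ε).1.2 =
      ∑ e with H.src e = T.emb v, ∑ f with H.src f = H.rng e, m e f := by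
  rw [Finset.sum_sigma']
  refine Finset.sum_bij (fun ε _ => ⟨(T.θ ε).1.1, (T.θ ε).1.2⟩) ?_ ?_ ?_ ?_
  · intro ε hε
    simp only [Finset.mem_filter, Finset.mem_univ, true_and] at hε
    simp [T.src_θ, T.rng_fst, hε]
  · intro ε _ ε' _ h
    simp only [Sigma.mk.injEq, heq_eq_eq] at h
    exact T.θ_inj h.1 h.2
  · rintro ⟨e, f⟩ h
    simp only [Finset.mem_sigma, Finset.mem_filter, Finset.mem_univ, true_and] at h
    obtain ⟨ε, hε, hs⟩ := T.exists_θ h.2.symm h.1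
    exact ⟨ε, by simpa using hs, by simp [hε]⟩
  · intros
    rfl

variable (K) in
/-- The images in `L(H)` of the generators of `L(G)`. -/
def inclGen : Gen V E → Leavitt K H
  | .vert v => vert K H (T.emb v)
  | .edge e => gen K H (.edge (T.θ e).1.1) * gen K H (.edge (T.θ e).1.2)
  | .ghost e => gen K H (.ghost (T.θ e).1.2) * gen K H (.ghost (T.θ e).1.1)

/-- For the summation relation, `∑ e (∑ f f*) e* = ∑ e r(e) e* = ∑ e e*`, which is the vertex. The
inner sum needs that `r(e)` is not a sink of `H`. -/
theorem leavittFamily_inclGen (hH : H.NoSinks) : LeavittFamily G (T.inclGen K) := by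
  classical
  have h := leavittFamily_gen K H
  constructor
  · intro v w
    simp [inclGen, h.vert_mul_vert, T.emb_injective.eq_iff]
  · intro e
    simp only [inclGen, ← T.src_θ, ← mul_assoc, h.src_mul_edge]
  · intro e
    simp only [inclGen, ← T.rng_θ, mul_assoc, h.edge_mul_rng]
  · intro e
    simp only [inclGen, ← T.rng_θ, ← mul_assoc, h.rng_mul_ghost]
  · intro e
    simp only [inclGen, ← T.src_θ, mul_assoc, h.ghost_mul_src]
  · intro e f
    simp only [inclGen]
    rw [mul_assoc, ← mul_assoc (gen K H (.ghost (T.θ e).1.1)), h.ghost_mul_edge]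
    by_cases h₁ : (T.θ e).1.1 = (T.θ f).1.1
    · rw [if_pos h₁, ← mul_assoc, T.rng_fst, h.ghost_mul_src, h.ghost_mul_edge, T.rng_θ]
      by_cases h₂ : (T.θ e).1.2 = (T.θ f).1.2
      · rw [if_pos h₂, if_pos (T.θ_inj h₁ h₂)]
      · rw [if_neg h₂, if_neg (fun hef => h₂ (by rw [hef]))]
    · rw [if_neg h₁, if_neg (fun hef => h₁ (by rw [hef])), zero_mul, mul_zero]
  · intro v _
    have := T.sum_θ v fun e f => gen K H (.edge e) * gen K H (.edge f) *
      (gen K H (.ghost f) * gen K H (.ghost e))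
    simp only [inclGen]
    convert this using 1
    have h' (e f : F) : gen K H (.edge e) * gen K H (.edge f) *
        (gen K H (.ghost f) * gen K H (.ghost e)) = gen K H (.edge e) *
        (gen K H (.edge f) * gen K H (.ghost f)) * gen K H (.ghost e) := by
      simp only [mul_assoc]
    simp only [h', ← Finset.sum_mul, ← Finset.mul_sum]
    rw [vert, ← h.sum_edge_mul_ghost _ (hH _)]
    refine Finset.sum_congr (by ext; simp) fun e _ => ?_
    have := h.sum_edge_mul_ghost (H.rng e) (hH _)
    rw [show (∑ f with H.src f = H.rng e, gen K H (.edge f) * gen K H (.ghost f)) = _ by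
      convert this, h.edge_mul_rng]

/-! #### The representation of `L(H)` induced from the regular representation of `L(G)` -/

variable (K)

open scoped Classical in
/-- The vertex of `G` corresponding to a vertex of `H`, or zero. -/
noncomputable def vertOf (u : W) : Leavitt K G :=
  if h : ∃ v, u = T.emb v then vert K G h.choose else 0

open scoped Classical in
/-- The edge of `G` corresponding to a path of length two in `H`, or zero. -/
noncomputable def edgeOf (e f : F) : Leavitt K G :=
  if h : ∃ ε, (T.θ ε).1 = (e, f) then gen K G (.edge h.choose) else 0

open scoped Classical in
/-- The ghost edge of `G` corresponding to a path of length two in `H`, or zero. -/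
noncomputable def ghostOf (e f : F) : Leavitt K G :=
  if h : ∃ ε, (T.θ ε).1 = (e, f) then gen K G (.ghost h.choose) else 0

theorem vertOf_emb (v : V) : T.vertOf K (T.emb v) = vert K G v := by
  have h : ∃ v', T.emb v = T.emb v' := ⟨v, rfl⟩
  rw [vertOf, dif_pos h, T.emb_injective h.choose_spec.symm]

theorem vertOf_eq_zero {u : W} (h : ¬ ∃ v, u = T.emb v) : T.vertOf K u = 0 := dif_neg h

theorem edgeOf_θ {ε : E} {e f : F} (hε : (T.θ ε).1 = (e, f)) :
    T.edgeOf K e f = gen K G (.edge ε) := by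
  have h : ∃ ε', (T.θ ε').1 = (e, f) := ⟨ε, hε⟩
  rw [edgeOf, dif_pos h, T.θ.injective (Subtype.ext (h.choose_spec.trans hε.symm))]

theorem ghostOf_θ {ε : E} {e f : F} (hε : (T.θ ε).1 = (e, f)) :
    T.ghostOf K e f = gen K G (.ghost ε) := by
  have h : ∃ ε', (T.θ ε').1 = (e, f) := ⟨ε, hε⟩
  rw [ghostOf, dif_pos h, T.θ.injective (Subtype.ext (h.choose_spec.trans hε.symm))]

theorem edgeOf_eq_zero {e f : F} (h : ¬ ∃ ε, (T.θ ε).1 = (e, f)) : T.edgeOf K e f = 0 :=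
  dif_neg h

theorem ghostOf_eq_zero {e f : F} (h : ¬ ∃ ε, (T.θ ε).1 = (e, f)) : T.ghostOf K e f = 0 :=
  dif_neg h

open scoped Classical in
theorem vertOf_mul_vertOf (u u' : W) :
    T.vertOf K u * T.vertOf K u' = if u = u' then T.vertOf K u else 0 := by
  by_cases h : ∃ v, u = T.emb v
  · obtain ⟨v, rfl⟩ := h
    by_cases h' : ∃ v, u' = T.emb v
    · obtain ⟨v', rfl⟩ := h'
      simp [vertOf_emb, (leavittFamily_gen K G).vert_mul_vert, T.emb_injective.eq_iff]
    · rw [T.vertOf_eq_zero K h', mul_zero, if_neg (fun h => h' ⟨v, h.symm⟩)]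
  · simp [T.vertOf_eq_zero K h]

theorem vertOf_mul_self (u : W) : T.vertOf K u * T.vertOf K u = T.vertOf K u := by
  rw [vertOf_mul_vertOf, if_pos rfl]

theorem src_mul_edgeOf (e f : F) : T.vertOf K (H.src e) * T.edgeOf K e f = T.edgeOf K e f := by
  by_cases h : ∃ ε, (T.θ ε).1 = (e, f)
  · obtain ⟨ε, hε⟩ := h
    have hs := T.src_θ ε
    rw [hε] at hs
    rw [T.edgeOf_θ K hε, hs, vertOf_emb, (leavittFamily_gen K G).src_mul_edge]
  · rw [T.edgeOf_eq_zero K h, mul_zero]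

theorem edgeOf_mul_rng (e f : F) : T.edgeOf K e f * T.vertOf K (H.rng f) = T.edgeOf K e f := by
  by_cases h : ∃ ε, (T.θ ε).1 = (e, f)
  · obtain ⟨ε, hε⟩ := h
    have hs := T.rng_θ ε
    rw [hε] at hs
    rw [T.edgeOf_θ K hε, hs, vertOf_emb, (leavittFamily_gen K G).edge_mul_rng]
  · rw [T.edgeOf_eq_zero K h, zero_mul]

theorem ghostOf_mul_src (e f : F) : T.ghostOf K e f * T.vertOf K (H.src e) = T.ghostOf K e f := by
  by_cases h : ∃ ε, (T.θ ε).1 = (e, f)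
  · obtain ⟨ε, hε⟩ := h
    have hs := T.src_θ ε
    rw [hε] at hs
    rw [T.ghostOf_θ K hε, hs, vertOf_emb, (leavittFamily_gen K G).ghost_mul_src]
  · rw [T.ghostOf_eq_zero K h, zero_mul]

theorem rng_mul_ghostOf (e f : F) : T.vertOf K (H.rng f) * T.ghostOf K e f = T.ghostOf K e f := by
  by_cases h : ∃ ε, (T.θ ε).1 = (e, f)
  · obtain ⟨ε, hε⟩ := h
    have hs := T.rng_θ ε
    rw [hε] at hs
    rw [T.ghostOf_θ K hε, hs, vertOf_emb, (leavittFamily_gen K G).rng_mul_ghost]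
  · rw [T.ghostOf_eq_zero K h, mul_zero]

theorem edgeOf_eq_zero_of_ne {e f : F} (h : H.src f ≠ H.rng e) : T.edgeOf K e f = 0 := by
  refine T.edgeOf_eq_zero K ?_
  rintro ⟨ε, hε⟩
  have := T.rng_fst ε
  rw [hε] at this
  exact h this.symm

theorem ghostOf_eq_zero_of_ne {e f : F} (h : H.src f ≠ H.rng e) : T.ghostOf K e f = 0 := by
  refine T.ghostOf_eq_zero K ?_
  rintro ⟨ε, hε⟩
  have := T.rng_fst ε
  rw [hε] at this
  exact h this.symm

-- If the composable pair `(e, f)` is not a path from `G` to `G`, then `r(f)` is outside `G`: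
-- otherwise crossing twice would put `s(e)` in `G`. So the vertex on the right vanishes together
-- with the left side.
open scoped Classical in
theorem ghostOf_mul_edgeOf (e f e' f' : F) : T.ghostOf K e f * T.edgeOf K e' f' =
    if e = e' ∧ f = f' ∧ H.src f = H.rng e then T.vertOf K (H.rng f) else 0 := by
  by_cases hr : H.src f = H.rng e
  swap
  · rw [T.ghostOf_eq_zero_of_ne K hr, zero_mul, if_neg (fun h => hr h.2.2)]
  by_cases h : ∃ ε, (T.θ ε).1 = (e, f)
  · obtain ⟨ε, hε⟩ := h
    have hs := T.rng_θ ε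
    rw [hε] at hs
    rw [hs, vertOf_emb, T.ghostOf_θ K hε]
    by_cases h' : ∃ ε, (T.θ ε).1 = (e', f')
    · obtain ⟨ε', hε'⟩ := h'
      rw [T.edgeOf_θ K hε', (leavittFamily_gen K G).ghost_mul_edge]
      by_cases hee : ε = ε'
      · subst hee
        rw [hε, Prod.mk.injEq] at hε'
        rw [if_pos rfl, if_pos ⟨hε'.1, hε'.2, hr⟩]
      · rw [if_neg hee, if_neg]
        rintro ⟨rfl, rfl, -⟩
        exact hee (T.θ.injective (Subtype.ext (hε.trans hε'.symm)))
    · rw [T.edgeOf_eq_zero K h', mul_zero, if_neg]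
      rintro ⟨rfl, rfl, -⟩
      exact h' ⟨ε, hε⟩
  · rw [T.ghostOf_eq_zero K h, zero_mul, T.vertOf_eq_zero K, ite_self]
    rintro ⟨v, hv⟩
    have hf : ¬ ∃ v, H.src f = T.emb v := fun hf => (T.src_iff f).1 hf ⟨v, hv⟩
    rw [hr, ← T.src_iff] at hf
    obtain ⟨v', hv'⟩ := hf
    obtain ⟨ε, hε, -⟩ := T.exists_θ hr.symm hv'
    exact h ⟨ε, hε⟩

-- The sum over all `f` is harmless, as the terms vanish when `(e, f)` is not composable. Absence of
-- sinks in `H` supplies a path of length two from `v`, so `v` is not a sink of `G` and its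
-- summation relation is available.
open scoped Classical in
theorem sum_edgeOf_mul_ghostOf (hH : H.NoSinks) (u : W) :
    ∑ e with H.src e = u, ∑ f, T.edgeOf K e f * T.ghostOf K e f = T.vertOf K u := by
  by_cases h : ∃ v, u = T.emb v
  · obtain ⟨v, rfl⟩ := h
    have hs (e : F) : ∑ f, T.edgeOf K e f * T.ghostOf K e f =
        ∑ f with H.src f = H.rng e, T.edgeOf K e f * T.ghostOf K e f := by
      symm
      refine Finset.sum_filter_of_ne fun f _ hf => ?_
      by_contra hne
      exact hf (by rw [T.edgeOf_eq_zero_of_ne K hne, zero_mul])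
    obtain ⟨e, he⟩ := hH (T.emb v)
    obtain ⟨f, hf⟩ := hH (H.rng e)
    obtain ⟨ε, -, hε⟩ := T.exists_θ hf.symm he
    rw [vertOf_emb, vert, ← (leavittFamily_gen K G).sum_edge_mul_ghost v ⟨ε, hε⟩]
    simp only [hs]
    rw [← T.sum_θ]
    refine Finset.sum_congr (by ext; simp) fun ε _ => ?_
    rw [T.edgeOf_θ K rfl, T.ghostOf_θ K rfl]
  · rw [T.vertOf_eq_zero K h]
    refine Finset.sum_eq_zero fun e he => Finset.sum_eq_zero fun f _ => ?_
    rw [Finset.mem_filter] at he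
    rw [← src_mul_edgeOf, he.2, T.vertOf_eq_zero K h, zero_mul, zero_mul]

open scoped Classical in
/-- The action of a generator of `L(H)` on the space `L(G) × (F → L(G))`, which contains
`L(H)p` as the set of pairs `(a, b)` with `b f ∈ r(f) L(G)`. -/
noncomputable def actGen : Gen W F → Module.End K (Leavitt K G × (F → Leavitt K G))
  | .vert u =>
    { toFun := fun m =>
        (T.vertOf K u * m.1, fun f => if H.src f = u then T.vertOf K (H.rng f) * m.2 f else 0)
      map_add' := fun m n => by ext f <;> simp [mul_add]; split <;> simp
      map_smul' := fun k m => by ext f <;> simp }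
  | .edge e =>
    { toFun := fun m =>
        (∑ f, T.edgeOf K e f * m.2 f, fun f => if f = e then T.vertOf K (H.rng e) * m.1 else 0)
      map_add' := fun m n => by
        ext f <;> simp [mul_add, Finset.sum_add_distrib]; split <;> simp
      map_smul' := fun k m => by ext f <;> simp [Finset.smul_sum] }
  | .ghost e =>
    { toFun := fun m => (T.vertOf K (H.rng e) * m.2 e, fun f => T.ghostOf K e f * m.1)
      map_add' := fun m n => by ext f <;> simp [mul_add]
      map_smul' := fun k m => by ext f <;> simp }

open scoped Classical in
theorem actGen_vert (u : W) (m : Leavitt K G × (F → Leavitt K G)) :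
    T.actGen K (.vert u) m =
      (T.vertOf K u * m.1, fun f => if H.src f = u then T.vertOf K (H.rng f) * m.2 f else 0) := rfl

open scoped Classical in
theorem actGen_edge (e : F) (m : Leavitt K G × (F → Leavitt K G)) :
    T.actGen K (.edge e) m = (∑ f, T.edgeOf K e f * m.2 f,
      fun f => if f = e then T.vertOf K (H.rng e) * m.1 else 0) := rfl

theorem actGen_ghost (e : F) (m : Leavitt K G × (F → Leavitt K G)) :
    T.actGen K (.ghost e) m =
      (T.vertOf K (H.rng e) * m.2 e, fun f => T.ghostOf K e f * m.1) := rfl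

/-- The operators imitate left multiplication on `a + ∑ f b_f`. The relations hold on all pairs, not
only on those with `b f ∈ r(f) L(G)`, because every formula contains the vertex that projects onto
this set. For the same reason the vertices may sum to a proper projection, so only the non-unital
universal property is applied. -/
theorem leavittFamily_actGen (hH : H.NoSinks) : LeavittFamily H (T.actGen K) := by
  classical
  constructor
  · intro u u'
    refine LinearMap.ext fun m => Prod.ext ?_ (funext fun f => ?_)
    · rw [Module.End.mul_apply, actGen_vert, actGen_vert, ← mul_assoc, vertOf_mul_vertOf]
      split
      · rfl
      · simp
    · rw [Module.End.mul_apply, actGen_vert, actGen_vert]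
      by_cases h : u = u'
      · subst h
        rw [if_pos rfl, actGen_vert]
        dsimp only
        split
        · rw [← mul_assoc, vertOf_mul_self]
        · rfl
      · rw [if_neg h]
        dsimp only
        by_cases h₁ : H.src f = u
        · rw [if_pos h₁, if_neg (fun h₂ => h (h₁.symm.trans h₂)), mul_zero]
          rfl
        · rw [if_neg h₁]
          rfl
  · intro e
    refine LinearMap.ext fun m => Prod.ext ?_ (funext fun f => ?_)
    · rw [Module.End.mul_apply, actGen_vert, actGen_edge]
      simp only [Finset.mul_sum, ← mul_assoc, src_mul_edgeOf]
    · rw [Module.End.mul_apply, actGen_vert, actGen_edge]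
      dsimp only
      by_cases h : f = e
      · subst h
        rw [if_pos rfl, if_pos rfl, ← mul_assoc, vertOf_mul_self]
      · rw [if_neg h, mul_zero, ite_self]
  · intro e
    refine LinearMap.ext fun m => Prod.ext ?_ (funext fun f => ?_)
    · rw [Module.End.mul_apply, actGen_vert, actGen_edge, actGen_edge]
      refine Finset.sum_congr rfl fun f _ => ?_
      dsimp only
      split
      · rw [← mul_assoc, edgeOf_mul_rng]
      · next h => rw [T.edgeOf_eq_zero_of_ne K h, zero_mul, zero_mul]
    · rw [Module.End.mul_apply, actGen_vert, actGen_edge, actGen_edge]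
      dsimp only
      rw [← mul_assoc, vertOf_mul_self]
  · intro e
    refine LinearMap.ext fun m => Prod.ext ?_ (funext fun f => ?_)
    · rw [Module.End.mul_apply, actGen_vert, actGen_ghost, ← mul_assoc, vertOf_mul_self]
    · rw [Module.End.mul_apply, actGen_vert, actGen_ghost]
      dsimp only
      split
      · rw [← mul_assoc, rng_mul_ghostOf]
      · next h => rw [T.ghostOf_eq_zero_of_ne K h, zero_mul]
  · intro e
    refine LinearMap.ext fun m => Prod.ext ?_ (funext fun f => ?_)
    · rw [Module.End.mul_apply, actGen_vert, actGen_ghost, actGen_ghost]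
      dsimp only
      rw [if_pos rfl, ← mul_assoc, vertOf_mul_self]
    · rw [Module.End.mul_apply, actGen_vert, actGen_ghost, actGen_ghost]
      dsimp only
      rw [← mul_assoc, ghostOf_mul_src]
  · intro e e'
    refine LinearMap.ext fun m => Prod.ext ?_ (funext fun f => ?_)
    · rw [Module.End.mul_apply, actGen_edge, actGen_ghost]
      dsimp only
      split
      · next h =>
        subst h
        rw [actGen_vert, ← mul_assoc, vertOf_mul_self]
      · rw [mul_zero]
        rfl
    · rw [Module.End.mul_apply, actGen_edge, actGen_ghost]
      simp only [Finset.mul_sum, ← mul_assoc, ghostOf_mul_edgeOf, ite_mul, zero_mul]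
      by_cases h : e = e'
      · subst h
        rw [if_pos rfl, actGen_vert]
        simp [ite_and]
      · simp [h]
  -- `e e*` keeps only the coordinate `f = e` of the second component. On the first component the
  -- sum is `sum_edgeOf_mul_ghostOf`.
  · intro u _
    refine LinearMap.ext fun m => ?_
    rw [LinearMap.sum_apply]
    have hm (e : F) : (T.actGen K (.edge e) * T.actGen K (.ghost e)) m =
        ((∑ f, T.edgeOf K e f * T.ghostOf K e f) * m.1,
          fun f => if f = e then T.vertOf K (H.rng e) * m.2 e else 0) := by
      rw [Module.End.mul_apply, actGen_ghost, actGen_edge]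
      simp only [Finset.sum_mul, ← mul_assoc, vertOf_mul_self]
    simp only [hm]
    refine Prod.ext ?_ (funext fun f => ?_)
    · rw [Prod.fst_sum, ← Finset.sum_mul, sum_edgeOf_mul_ghostOf K T hH, actGen_vert]
    · rw [Prod.snd_sum, Finset.sum_apply, actGen_vert]
      simp [Finset.sum_ite_eq]

/-! ### The embedding of `L(G)` and the identification of the corner -/

variable (hH : H.NoSinks)

/-- The non-unital embedding of `L(G)` into `L(H)`. -/
noncomputable def incl : Leavitt K G →ₙₐ[K] Leavitt K H :=
  (exists_lift (T.leavittFamily_inclGen (K := K) hH)).choose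

theorem incl_gen (g : Gen V E) : T.incl K hH (gen K G g) = T.inclGen K g :=
  (exists_lift (T.leavittFamily_inclGen (K := K) hH)).choose_spec g

/-- The representation of `L(H)` on `L(G) × (F → L(G))`. -/
noncomputable def rep : Leavitt K H →ₙₐ[K] Module.End K (Leavitt K G × (F → Leavitt K G)) :=
  (exists_lift (T.leavittFamily_actGen K hH)).choose

theorem rep_gen (g : Gen W F) : T.rep K hH (gen K H g) = T.actGen K g :=
  (exists_lift (T.leavittFamily_actGen K hH)).choose_spec g

/-- The sum in `L(H)` of the vertices of `G`. -/
def idem : Leavitt K H := ∑ v, vert K H (T.emb v)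

theorem incl_one : T.incl K hH 1 = T.idem K := by
  rw [← sum_vert, map_sum]
  exact Finset.sum_congr rfl fun v _ => T.incl_gen K hH _

open scoped Classical in
theorem idem_mul_vert (u : W) :
    T.idem K * vert K H u = if ∃ v, u = T.emb v then vert K H u else 0 := by
  rw [idem, Finset.sum_mul]
  simp only [vert, (leavittFamily_gen K H).vert_mul_vert]
  by_cases h : ∃ v, u = T.emb v
  · obtain ⟨v, rfl⟩ := h
    rw [if_pos ⟨v, rfl⟩]
    simp [T.emb_injective.eq_iff]
  · rw [if_neg h]
    exact Finset.sum_eq_zero fun v _ => if_neg fun hv => h ⟨v, hv.symm⟩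

open scoped Classical in
theorem vert_mul_idem (u : W) :
    vert K H u * T.idem K = if ∃ v, u = T.emb v then vert K H u else 0 := by
  rw [idem, Finset.mul_sum]
  simp only [vert, (leavittFamily_gen K H).vert_mul_vert]
  by_cases h : ∃ v, u = T.emb v
  · obtain ⟨v, rfl⟩ := h
    rw [if_pos ⟨v, rfl⟩]
    simp [T.emb_injective.eq_iff]
  · rw [if_neg h]
    exact Finset.sum_eq_zero fun v _ => if_neg fun hv => h ⟨v, hv⟩

theorem isIdempotentElem_idem : IsIdempotentElem (T.idem K) := by
  change T.idem K * T.idem K = T.idem K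
  conv_lhs => enter [2]; rw [idem]
  rw [Finset.mul_sum, idem]
  exact Finset.sum_congr rfl fun v _ => by
    have := T.idem_mul_vert K (T.emb v)
    rwa [if_pos ⟨v, rfl⟩] at this

open scoped Classical in
theorem idem_mul_edge (e : F) : T.idem K * gen K H (.edge e) =
    if ∃ v, H.src e = T.emb v then gen K H (.edge e) else 0 := by
  rw [← (leavittFamily_gen K H).src_mul_edge, ← mul_assoc, ← vert, idem_mul_vert]
  split
  · rfl
  · rw [zero_mul]

open scoped Classical in
theorem edge_mul_idem (e : F) : gen K H (.edge e) * T.idem K =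
    if ∃ v, H.rng e = T.emb v then gen K H (.edge e) else 0 := by
  rw [← (leavittFamily_gen K H).edge_mul_rng, mul_assoc, ← vert, vert_mul_idem]
  split
  · rfl
  · rw [mul_zero]

open scoped Classical in
theorem idem_mul_ghost (e : F) : T.idem K * gen K H (.ghost e) =
    if ∃ v, H.rng e = T.emb v then gen K H (.ghost e) else 0 := by
  rw [← (leavittFamily_gen K H).rng_mul_ghost, ← mul_assoc, ← vert, idem_mul_vert]
  split
  · rfl
  · rw [zero_mul]

open scoped Classical in
theorem ghost_mul_idem (e : F) : gen K H (.ghost e) * T.idem K =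
    if ∃ v, H.src e = T.emb v then gen K H (.ghost e) else 0 := by
  rw [← (leavittFamily_gen K H).ghost_mul_src, mul_assoc, ← vert, vert_mul_idem]
  split
  · rfl
  · rw [mul_zero]

/-- No edge has both ends in `G`. -/
theorem idem_mul_edge_mul_idem (e : F) : T.idem K * (gen K H (.edge e) * T.idem K) = 0 := by
  classical
  rw [edge_mul_idem]
  split
  · next h => rw [idem_mul_edge, if_neg fun h' => (T.src_iff e).1 h' h]
  · rw [mul_zero]

include hH in
/-- The complement of `idem` is generated by the edges that end in `G`. -/
theorem sum_edge_mul_idem_mul_ghost :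
    ∑ f, gen K H (.edge f) * T.idem K * gen K H (.ghost f) = 1 - T.idem K := by
  classical
  -- If `u` is in `G`, its edges end outside `G` and every term vanishes. If not, its edges end in
  -- `G`, `p` is absorbed, and the summation relation at `u` leaves `u`.
  have h1 : ∀ u, ∑ f with H.src f = u, gen K H (.edge f) * T.idem K * gen K H (.ghost f) =
      vert K H u - T.idem K * vert K H u := by
    intro u
    rw [idem_mul_vert]
    have h2 : ∀ f ∈ Finset.univ.filter fun f => H.src f = u,
        gen K H (.edge f) * T.idem K * gen K H (.ghost f) =
          if ∃ v, u = T.emb v then 0 else gen K H (.edge f) * gen K H (.ghost f) := by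
      intro f hf
      obtain rfl := (Finset.mem_filter.1 hf).2
      rw [edge_mul_idem]
      by_cases h : ∃ v, H.src f = T.emb v
      · rw [if_pos h, if_neg ((T.src_iff f).1 h), zero_mul]
      · rw [if_neg h, if_pos (by_contra fun h' => h ((T.src_iff f).2 h'))]
    rw [Finset.sum_congr rfl h2]
    split
    · simp
    · rw [sub_zero, vert, ← (leavittFamily_gen K H).sum_edge_mul_ghost u (hH u)]
  rw [← Finset.sum_fiberwise (s := Finset.univ) (g := H.src)]
  simp only [h1, Finset.sum_sub_distrib, ← Finset.mul_sum, sum_vert, mul_one]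

theorem incl_eq_idem_mul (a : Leavitt K G) :
    T.incl K hH a = T.idem K * T.incl K hH a := by
  rw [← T.incl_one K hH, ← map_mul, one_mul]

theorem incl_vertOf (u : W) : T.incl K hH (T.vertOf K u) = vert K H u * T.idem K := by
  classical
  rw [vert_mul_idem]
  split
  · next h =>
    obtain ⟨v, rfl⟩ := h
    rw [vertOf_emb, vert, incl_gen, inclGen]
  · next h => rw [T.vertOf_eq_zero K h, map_zero]

/-- When `(e, f)` is not a path from `G` to `G`, the right side vanishes too: either `f` ends
outside `G` and `f p = 0`, or `f` starts outside `G` and `e f ≠ 0` would force `e` to start in `G`.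
-/
theorem incl_edgeOf (e f : F) : T.incl K hH (T.edgeOf K e f) =
    gen K H (.edge e) * gen K H (.edge f) * T.idem K := by
  classical
  have h := leavittFamily_gen K H
  by_cases hε : ∃ ε, (T.θ ε).1 = (e, f)
  · obtain ⟨ε, hε⟩ := hε
    have hr := T.rng_θ ε
    rw [hε] at hr
    rw [T.edgeOf_θ K hε, incl_gen, mul_assoc, edge_mul_idem, if_pos ⟨_, hr⟩, inclGen, hε]
  · rw [T.edgeOf_eq_zero K hε, map_zero, mul_assoc, edge_mul_idem]
    split
    · next hf =>
      have hs : ¬ ∃ v, H.src f = T.emb v := fun hs => (T.src_iff f).1 hs hf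
      rw [← h.edge_mul_rng e, ← h.src_mul_edge f, mul_assoc,
        ← mul_assoc (gen K H (.vert (H.rng e))), h.vert_mul_vert]
      split
      · next hef =>
        rw [← hef, ← T.src_iff] at hs
        obtain ⟨v, hv⟩ := hs
        obtain ⟨ε, hε', -⟩ := T.exists_θ hef hv
        exact absurd ⟨ε, hε'⟩ hε
      · rw [zero_mul, mul_zero]
    · rw [mul_zero]

theorem incl_ghostOf (e f : F) : T.incl K hH (T.ghostOf K e f) =
    T.idem K * gen K H (.ghost f) * gen K H (.ghost e) := by
  classical
  have h := leavittFamily_gen K H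
  by_cases hε : ∃ ε, (T.θ ε).1 = (e, f)
  · obtain ⟨ε, hε⟩ := hε
    have hr := T.rng_θ ε
    rw [hε] at hr
    rw [T.ghostOf_θ K hε, incl_gen, idem_mul_ghost, if_pos ⟨_, hr⟩, inclGen, hε]
  · rw [T.ghostOf_eq_zero K hε, map_zero, idem_mul_ghost]
    split
    · next hf =>
      have hs : ¬ ∃ v, H.src f = T.emb v := fun hs => (T.src_iff f).1 hs hf
      rw [← h.rng_mul_ghost e, ← h.ghost_mul_src f, mul_assoc,
        ← mul_assoc (gen K H (.vert (H.src f))), h.vert_mul_vert]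
      split
      · next hef =>
        rw [hef, ← T.src_iff] at hs
        obtain ⟨v, hv⟩ := hs
        obtain ⟨ε, hε', -⟩ := T.exists_θ hef.symm hv
        exact absurd ⟨ε, hε'⟩ hε
      · rw [zero_mul, mul_zero]
    · rw [zero_mul]

/-- The equivariant map from the representation space onto `L(H)p`. -/
noncomputable def toIdeal : Leavitt K G × (F → Leavitt K G) →ₗ[K] Leavitt K H where
  toFun m := T.incl K hH m.1 + ∑ f, gen K H (.edge f) * T.incl K hH (m.2 f)
  map_add' m n := by
    simp only [Prod.fst_add, Prod.snd_add, Pi.add_apply, map_add, mul_add, Finset.sum_add_distrib]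
    abel
  map_smul' k m := by
    simp [smul_add, Finset.smul_sum]

theorem toIdeal_apply (m : Leavitt K G × (F → Leavitt K G)) :
    T.toIdeal K hH m = T.incl K hH m.1 + ∑ f, gen K H (.edge f) * T.incl K hH (m.2 f) := rfl

/-- Equivariance is multiplicative and linear in `c`, so the generators suffice. It confirms that
the formulas of `actGen` really describe left multiplication in `L(H)`. -/
theorem toIdeal_rep (c : Leavitt K H) (m : Leavitt K G × (F → Leavitt K G)) :
    T.toIdeal K hH (T.rep K hH c m) = c * T.toIdeal K hH m := by
  classical
  have h := leavittFamily_gen K H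
  induction c using Leavitt.induction generalizing m with
  | zero => simp
  | gen g =>
    rw [rep_gen]
    cases g with
    | vert u =>
      rw [actGen_vert, toIdeal_apply, toIdeal_apply, mul_add]
      congr 1
      · rw [map_mul, incl_vertOf, mul_assoc, ← incl_eq_idem_mul]
      · rw [Finset.mul_sum]
        refine Finset.sum_congr rfl fun f _ => ?_
        dsimp only
        rw [← mul_assoc, ← h.src_mul_edge f, ← mul_assoc, h.vert_mul_vert]
        by_cases hf : H.src f = u
        · subst hf
          rw [if_pos rfl, if_pos rfl, map_mul, incl_vertOf, h.src_mul_edge,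
            mul_assoc (vert K H _), ← incl_eq_idem_mul, ← mul_assoc, vert, h.edge_mul_rng]
        · rw [if_neg hf, if_neg (Ne.symm hf), map_zero, mul_zero, zero_mul, zero_mul]
    | edge e =>
      -- Edges exchange the two summands, whence `add_comm`; ghost edges do the same.
      rw [actGen_edge, toIdeal_apply, toIdeal_apply, mul_add, add_comm]
      congr 1
      · dsimp only
        rw [Finset.sum_eq_single e (fun f _ hf => by rw [if_neg hf, map_zero, mul_zero])
          (fun he => absurd (Finset.mem_univ e) he), if_pos rfl, map_mul, incl_vertOf,
          mul_assoc, ← incl_eq_idem_mul, ← mul_assoc, vert, h.edge_mul_rng]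
      · rw [map_sum, Finset.mul_sum]
        refine Finset.sum_congr rfl fun f _ => ?_
        rw [map_mul, incl_edgeOf, mul_assoc, ← incl_eq_idem_mul, mul_assoc]
    | ghost e =>
      rw [actGen_ghost, toIdeal_apply, toIdeal_apply, mul_add, add_comm]
      congr 1
      -- The sum is `(1 - p) e* incl m.1`. It equals `e* incl m.1` because `p e* p = 0`, as `e`
      -- cannot both start and end in `G`.
      · have h1 (f : F) : gen K H (.edge f) * T.incl K hH (T.ghostOf K e f * m.1) =
            gen K H (.edge f) * T.idem K * gen K H (.ghost f) *
              (gen K H (.ghost e) * T.incl K hH m.1) := by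
          rw [map_mul, incl_ghostOf]
          simp only [mul_assoc]
        simp only [h1]
        rw [← Finset.sum_mul, T.sum_edge_mul_idem_mul_ghost K hH, sub_mul, one_mul,
          T.incl_eq_idem_mul K hH m.1, ← mul_assoc (gen K H (.ghost e)), ghost_mul_idem]
        split
        · next hs => rw [← mul_assoc, idem_mul_ghost, if_neg ((T.src_iff e).1 hs), zero_mul,
            sub_zero]
        · rw [zero_mul, mul_zero, sub_zero]
      · rw [Finset.mul_sum, Finset.sum_eq_single e]
        · rw [map_mul, incl_vertOf, mul_assoc, ← incl_eq_idem_mul, ← mul_assoc,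
            h.ghost_mul_edge, if_pos rfl]
        · intro f _ hf
          rw [← mul_assoc, h.ghost_mul_edge, if_neg (Ne.symm hf), zero_mul]
        · exact fun he => absurd (Finset.mem_univ e) he
  | smul k a ha => rw [map_smul, LinearMap.smul_apply, map_smul, ha, smul_mul_assoc]
  | mul a b ha hb => rw [map_mul, Module.End.mul_apply, ha, hb, mul_assoc]
  | add a b ha hb => rw [map_add, LinearMap.add_apply, map_add, ha, hb, add_mul]

/-- On the first factor `L(G)` acts by its regular representation, so `a` is recovered from the
image of `(1, 0)`. This is where injectivity of `incl` comes from. -/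
theorem rep_incl (a x : Leavitt K G) : T.rep K hH (T.incl K hH a) (x, 0) = (a * x, 0) := by
  classical
  have h := leavittFamily_gen K G
  induction a using Leavitt.induction generalizing x with
  | zero =>
    rw [map_zero, map_zero, zero_mul]
    rfl
  | gen g =>
    rw [incl_gen]
    cases g with
    | vert v =>
      rw [inclGen, vert, rep_gen, actGen_vert, vertOf_emb]
      refine Prod.ext rfl (funext fun f => ?_)
      simp
    | edge ε =>
      rw [inclGen, map_mul, Module.End.mul_apply, rep_gen, rep_gen, actGen_edge, actGen_edge]
      refine Prod.ext ?_ (funext fun f => ?_)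
      · simp only [mul_ite, mul_zero, Finset.sum_ite_eq', Finset.mem_univ, if_true]
        rw [← mul_assoc, edgeOf_mul_rng, T.edgeOf_θ K rfl]
      · simp
    | ghost ε =>
      rw [inclGen, map_mul, Module.End.mul_apply, rep_gen, rep_gen, actGen_ghost, actGen_ghost]
      refine Prod.ext ?_ (funext fun f => ?_)
      · dsimp only
        rw [← mul_assoc, rng_mul_ghostOf, T.ghostOf_θ K rfl]
      · simp
  | smul k a ha =>
    rw [map_smul, map_smul, LinearMap.smul_apply, ha, smul_mul_assoc, Prod.smul_mk, smul_zero]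
  | mul a b ha hb => rw [map_mul, map_mul, Module.End.mul_apply, hb, ha, mul_assoc]
  | add a b ha hb =>
    rw [map_add, map_add, LinearMap.add_apply, ha, hb, Prod.mk_add_mk, add_mul, add_zero]

/-- The map `c ↦ pcp` from `L(H)` to the corner, followed by its identification with `L(G)`. -/
noncomputable def compress : Leavitt K H →+ Leavitt K G where
  toFun c := (T.rep K hH c (1, 0)).1
  map_zero' := by rw [map_zero]; rfl
  map_add' c d := by rw [map_add]; rfl

theorem compress_incl (a : Leavitt K G) : T.compress K hH (T.incl K hH a) = a := by
  change (T.rep K hH (T.incl K hH a) (1, 0)).1 = a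
  rw [rep_incl, mul_one]

/-- As `toIdeal (1, 0) = p`, equivariance writes `cp` as `incl a + ∑ f * incl (b f)` with `a =
compress c`. Left multiplication by `p` kills the sum, since `p f p = 0`. -/
theorem incl_compress (c : Leavitt K H) :
    T.incl K hH (T.compress K hH c) = T.idem K * c * T.idem K := by
  have h := T.toIdeal_rep K hH c (1, 0)
  have h1 : T.toIdeal K hH (1, 0) = T.idem K := by
    rw [toIdeal_apply, incl_one]
    simp
  rw [h1] at h
  rw [mul_assoc, ← h, toIdeal_apply, mul_add, ← incl_eq_idem_mul, Finset.mul_sum,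
    Finset.sum_eq_zero, add_zero]
  · rfl
  · intro f _
    rw [incl_eq_idem_mul, ← mul_assoc (gen K H (.edge f)), ← mul_assoc,
      idem_mul_edge_mul_idem, zero_mul]

/-! ### Degrees and fullness -/

section Grading

variable {Γ : Type*} [AddCommGroup Γ] (γ : Γ)

theorem incl_mem_grading {δ : Γ} {a : Leavitt K G} (ha : a ∈ grading K G (fun _ => γ + γ) δ) :
    T.incl K hH a ∈ grading K H (fun _ => γ) δ := by
  refine lift_mem_of_mem_grading (grading K H fun _ => γ) (T.incl K hH) (fun _ => γ + γ)
    (fun g => ?_) ha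
  have hg := gen_mem_grading (K := K) H (fun _ => γ)
  rw [incl_gen]
  cases g with
  | vert v => exact hg (.vert _)
  | edge e => exact SetLike.mul_mem_graded (hg (.edge _)) (hg (.edge _))
  | ghost e =>
    rw [genDeg, neg_add]
    exact SetLike.mul_mem_graded (hg (.ghost _)) (hg (.ghost _))

theorem idem_mem_grading : T.idem K ∈ grading K H (fun _ => γ) 0 :=
  sum_mem fun v _ => gen_mem_grading H (fun _ => γ) (.vert (T.emb v))

theorem incl_mem_grading_iff [DecidableEq Γ] {δ : Γ} {a : Leavitt K G} :
    T.incl K hH a ∈ grading K H (fun _ => γ) δ ↔ a ∈ grading K G (fun _ => γ + γ) δ :=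
  ⟨mem_of_map_mem (grading K G (fun _ => γ + γ)) (grading K H (fun _ => γ))
    (T.incl K hH : Leavitt K G →+ Leavitt K H)
    (Function.LeftInverse.injective (T.compress_incl K hH))
    (fun _ _ => T.incl_mem_grading K hH γ), T.incl_mem_grading K hH γ⟩

/-- Since `incl` reflects degrees, it is enough that `pcp` has the degree of `c`. -/
theorem compress_mem_grading [DecidableEq Γ] {δ : Γ} {c : Leavitt K H}
    (hc : c ∈ grading K H (fun _ => γ) δ) :
    T.compress K hH c ∈ grading K G (fun _ => γ + γ) δ := by
  rw [← T.incl_mem_grading_iff K hH γ, incl_compress]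
  have hp := T.idem_mem_grading K γ
  have := SetLike.mul_mem_graded (SetLike.mul_mem_graded hp hc) hp
  rwa [zero_add, add_zero] at this

-- Multiply `1 = p + ∑ f p f*` by `c` on the right.
include hH in
theorem closure_mul_idem_mul :
    AddSubgroup.closure {x : Leavitt K H | ∃ a b, x = a * T.idem K * b} = ⊤ := by
  rw [eq_top_iff]
  intro c _
  have h : c = T.idem K * T.idem K * c +
      ∑ f, gen K H (.edge f) * T.idem K * (gen K H (.ghost f) * c) := by
    simp only [← mul_assoc]
    rw [(T.isIdempotentElem_idem K).eq, ← Finset.sum_mul, T.sum_edge_mul_idem_mul_ghost K hH,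
      ← add_mul, add_sub_cancel, one_mul]
  rw [h]
  exact add_mem (AddSubgroup.subset_closure ⟨_, _, rfl⟩)
    (sum_mem fun f _ => AddSubgroup.subset_closure ⟨_, _, rfl⟩)

/-- `L(G)` is isomorphic to the corner of `L(H)` at `idem`. -/
noncomputable def cornerEquiv : Leavitt K G ≃+* (T.isIdempotentElem_idem K).Corner where
  toFun a := ⟨T.incl K hH a, T.incl K hH a, by
    simp only [← T.incl_one K hH, ← map_mul, one_mul, mul_one]⟩
  invFun c := T.compress K hH c.1
  left_inv a := T.compress_incl K hH a
  right_inv c := Subtype.ext <| by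
    obtain ⟨h₁, h₂⟩ := (Subsemigroup.mem_corner_iff (T.isIdempotentElem_idem K)).1 c.2
    change T.incl K hH (T.compress K hH c.1) = c.1
    rw [incl_compress, h₁, h₂]
  map_mul' a b := Subtype.ext (map_mul _ _ _)
  map_add' a b := Subtype.ext (map_add _ _ _)

include hH in
theorem isGradedFullCorner [DecidableEq Γ] :
    IsGradedFullCorner K (grading K G fun _ => γ + γ) (grading K H fun _ => γ) (T.idem K) :=
  ⟨T.idem_mem_grading K γ, T.closure_mul_idem_mul K hH, T.isIdempotentElem_idem K,
    T.cornerEquiv K hH, fun k a => map_smul (T.incl K hH) k a,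
    fun _ _ => (T.incl_mem_grading_iff K hH γ).symm⟩

end Grading

end PathEmbedding

/-- The realization of `L(G)` as a full graded corner of `L(H)`. -/
noncomputable def PathEmbedding.gradedCorner (K : Type u) [Field K] {V E W F : Type u} [Fintype V]
    [Fintype E] [Fintype W] [Fintype F] {G : DirGraph V E} {H : DirGraph W F}
    (T : PathEmbedding G H) (hH : H.NoSinks) {Γ : Type*} [AddCommGroup Γ] [DecidableEq Γ] (γ : Γ) :
    GradedCorner (Leavitt.grading K G fun _ => γ + γ) (Leavitt.grading K H fun _ => γ) where
  incl := (T.incl K hH : Leavitt K G →ₙ+* Leavitt K H)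
  compress := T.compress K hH
  compress_incl := T.compress_incl K hH
  incl_compress c := by
    change T.incl K hH _ = T.incl K hH 1 * c * T.incl K hH 1
    rw [incl_compress, incl_one]
  incl_mem := T.incl_mem_grading K hH γ
  compress_mem := T.compress_mem_grading K hH γ
  -- The witnesses come from `1 = p p + ∑ (f p)(p f*)`: `none` gives the summand `p p`, of degrees
  -- `0`, and `some f` the pair of degrees `γ` and `-γ`.
  I := Option F
  x i := i.elim (T.idem K) fun f => Leavitt.gen K H (.edge f) * T.idem K
  y i := i.elim (T.idem K) fun f => T.idem K * Leavitt.gen K H (.ghost f)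
  deg i := i.elim 0 fun _ => γ
  x_mem i := by
    cases i with
    | none => exact T.idem_mem_grading K γ
    | some f =>
      have := SetLike.mul_mem_graded (Leavitt.gen_mem_grading (K := K) H (fun _ => γ) (.edge f))
        (T.idem_mem_grading K γ)
      rwa [add_zero] at this
  y_mem i := by
    cases i with
    | none =>
      change T.idem K ∈ Leavitt.grading K H (fun _ => γ) (-(0 : Γ))
      rw [neg_zero]
      exact T.idem_mem_grading K γ
    | some f =>
      have := SetLike.mul_mem_graded (T.idem_mem_grading K γ)
        (Leavitt.gen_mem_grading (K := K) H (fun _ => γ) (.ghost f))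
      rwa [zero_add] at this
  x_mul i := by
    change _ * T.incl K hH 1 = _
    rw [incl_one]
    cases i with
    | none => exact T.isIdempotentElem_idem K
    | some f =>
      change Leavitt.gen K H (.edge f) * T.idem K * T.idem K = _
      rw [mul_assoc, (T.isIdempotentElem_idem K).eq]
      rfl
  mul_y i := by
    change T.incl K hH 1 * _ = _
    rw [incl_one]
    cases i with
    | none => exact T.isIdempotentElem_idem K
    | some f =>
      change T.idem K * (T.idem K * Leavitt.gen K H (.ghost f)) = _
      rw [← mul_assoc, (T.isIdempotentElem_idem K).eq]
      rfl
  sum_x_mul_y := by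
    rw [Fintype.sum_option]
    simp only [Option.elim_none, Option.elim_some]
    rw [(T.isIdempotentElem_idem K).eq]
    have h (f : F) : Leavitt.gen K H (.edge f) * T.idem K * (T.idem K * Leavitt.gen K H (.ghost f))
        = Leavitt.gen K H (.edge f) * T.idem K * Leavitt.gen K H (.ghost f) := by
      rw [mul_assoc, ← mul_assoc (T.idem K), (T.isIdempotentElem_idem K).eq, mul_assoc]
    simp only [h]
    rw [T.sum_edge_mul_idem_mul_ghost K hH, add_sub_cancel]

/-! ### Application to elementary strong shift equivalence -/

namespace ElementarySSEVia

variable {V₁ E₁ V₂ E₂ V₃ E₃ : Type*} {G₁ : DirGraph V₁ E₁} {G₂ : DirGraph V₂ E₂}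
  {G₃ : DirGraph V₃ E₃} (h : ElementarySSEVia G₁ G₂ G₃)

include h in
-- An edge of `G₁` or `G₂` out of a vertex corresponds to a path whose first edge leaves that vertex
-- in `G₃`.
theorem noSinks (h₁ : G₁.NoSinks) (h₂ : G₂.NoSinks) : G₃.NoSinks := by
  intro u
  obtain ⟨v | v, rfl⟩ := h.vertexEquiv.surjective u
  · obtain ⟨e, rfl⟩ := h₁ v
    exact ⟨_, h.src_θ₁ e⟩
  · obtain ⟨e, rfl⟩ := h₂ v
    exact ⟨_, h.src_θ₂ e⟩

/-- The first graph embeds as a graph of paths of length two. -/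
def pathEmbedding₁ : PathEmbedding G₁ G₃ where
  emb v := h.vertexEquiv (.inl v)
  emb_injective := h.vertexEquiv.injective.comp Sum.inl_injective
  src_iff e := by
    obtain ⟨v, w, hs, hr⟩ | ⟨w, v, hs, hr⟩ := h.edge_bipartite e <;> simp [hs, hr]
  θ := h.θ₁
  src_θ := h.src_θ₁
  rng_θ := h.rng_θ₁

/-- The second graph embeds as a graph of paths of length two. -/
def pathEmbedding₂ : PathEmbedding G₂ G₃ where
  emb v := h.vertexEquiv (.inr v)
  emb_injective := h.vertexEquiv.injective.comp Sum.inr_injective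
  src_iff e := by
    obtain ⟨v, w, hs, hr⟩ | ⟨w, v, hs, hr⟩ := h.edge_bipartite e <;> simp [hs, hr]
  θ := h.θ₂
  src_θ := h.src_θ₂
  rng_θ := h.rng_θ₂

end ElementarySSEVia

end DirGraph

theorem HalfInt.half_add_half : HalfInt.half + HalfInt.half = HalfInt.one :=
  Subtype.ext (by change (1 / 2 : ℚ) + 1 / 2 = 1; norm_num)

theorem theorem9p2 (K : Type u) [Field K] {V₁ E₁ V₂ E₂ V₃ E₃ : Type u}
    [Fintype V₁] [Fintype E₁] [Fintype V₂] [Fintype E₂] [Fintype V₃] [Fintype E₃]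
    (G₁ : DirGraph V₁ E₁) (G₂ : DirGraph V₂ E₂) (G₃ : DirGraph V₃ E₃)
    (h₁ : G₁.NoSinks) (h₂ : G₂.NoSinks) (h : DirGraph.ElementarySSEVia G₁ G₂ G₃) :
    GradedMoritaEquivalent
      (DirGraph.Leavitt.grading K G₁ fun _ => HalfInt.one)
      (DirGraph.Leavitt.grading K G₂ fun _ => HalfInt.one) ∧
    IsGradedFullCorner K
      (DirGraph.Leavitt.grading K G₁ fun _ => HalfInt.one)
      (DirGraph.Leavitt.grading K G₃ fun _ => HalfInt.half)
      (∑ v : V₁, DirGraph.Leavitt.vert K G₃ (h.vertexEquiv (.inl v))) ∧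
    IsGradedFullCorner K
      (DirGraph.Leavitt.grading K G₂ fun _ => HalfInt.one)
      (DirGraph.Leavitt.grading K G₃ fun _ => HalfInt.half)
      (∑ v : V₂, DirGraph.Leavitt.vert K G₃ (h.vertexEquiv (.inr v))) := by
  have h₃ := h.noSinks h₁ h₂
  -- Writing `1` as `1/2 + 1/2` brings the weights into the form `γ + γ` of a graph of paths of
  -- length two.
  rw [← HalfInt.half_add_half]
  exact ⟨(h.pathEmbedding₁.gradedCorner K h₃ HalfInt.half).gradedMoritaEquivalent.trans
      (h.pathEmbedding₂.gradedCorner K h₃ HalfInt.half).gradedMoritaEquivalent.symm,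
    h.pathEmbedding₁.isGradedFullCorner K h₃ HalfInt.half,
    h.pathEmbedding₂.isGradedFullCorner K h₃ HalfInt.half⟩
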